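/- Let $G$ be a matrix Lie group (a closed subgroup of $GL(m,\mathbb R)$ or $GL(m,\mathbb C)$) with Lie algebra $\mathfrak g$ and left translations $\Phi_q(s)=qs$, and let $N\ge 1$. For $t=0,\dots,N-1$ let $s_t:G\times\mathbb R^{n_x}\to G$, $f_t:G\times\mathbb R^{n_x}\times\mathbb R^{n_u}\to\mathbb R^{n_x}$ and $c_t:G\times\mathbb R^{n_x}\times\mathbb R^{n_u}\to\mathbb R$ be smooth and let $\mathbb U_t\subset\mathbb R^{n_u}$ be convex; let $c_N:G\times\mathbb R^{n_x}\to\mathbb R$ and $g_t:G\times\mathbb R^{n_x}\to\mathbb R^{n_g(t)}$ ($t=1,\dots,N$) be smooth; let $(\bar q_0,\bar x_0)\in G\times\mathbb R^{n_x}$, and let $M_{\rm fin}$ be an immersed submanifold of $G\times\mathbb R^{n_x}$. Consider the problem of minimizing $$\sum_{t=0}^{N-1}c_t(q_t,x_t,u_t)+c_N(q_N,x_N)$$ subject to $q_{t+1}=q_ts_t(q_t,x_t)$, $x_{t+1}=f_t(q_t,x_t,u_t)$, $u_t\in\mathbb U_t$ for $t=0,\dots,N-1$; $g_t(q_t,x_t)\le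 0$ (componentwise) for $t=1,\dots,N$; $(q_0,x_0)=(\bar q_0,\bar x_0)$; and $(q_N,x_N)\in M_{\rm fin}$. Assume that there is an open set $\mathcal O\subset\mathfrak g$ such that $\exp:\mathcal O\to\exp(\mathcal O)$ is a diffeomorphism onto an open subset of $G$ and $s_t(q_t,x_t)\in\exp(\mathcal O)$ for all $t=0,\dots,N-1$ along every feasible trajectory; $\exp^{-1}$ denotes the inverse of this diffeomorphism. For $\nu\in\mathbb R$ define $$H^\nu(t,\zeta,\xi,q,x,u)=\nu c_t(q,x,u)+\langle\zeta,\exp^{-1}(s_t(q,x))\rangle+\langle\xi,f_t(q,x,u)\rangle,\qquad \zeta\in\mathfrak g^*,\ \xi\in(\mathbb R^{n_x})^*.$$ Let $(\mathring u_t)_{t=0}^{N-1}$ be an optimal controller with state trajectory $(\mathring q_t,\mathring x_t)_{t=0}^{N}$. Then there exist $(\zeta^t,\xi^t)\in\mathfrak g^*\times(\mathbb R^{n_x})^*$ for $t=0,\dots,N-1$, covectors $\mu^t\in(\mathbb R^{n_g(t)})^*$ for $t=1,\dots,N$, and $\nu\in\{-1,0\}$ such that, with $\gamma_t=(t,\zeta^t,\xi^t,\mathring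 q_t,\mathring x_t,\mathring u_t)$, $\eta_t=\mathcal D_\zeta H^\nu(\gamma_t)\in\mathfrak g$ and $$\rho^t=\big(\mathcal D\exp^{-1}(e^{\eta_t})\circ T_e\Phi_{e^{\eta_t}}\big)^*(\zeta^t)\in\mathfrak g^*,$$ the following hold: (i) $\mathring q_{t+1}=\mathring q_te^{\eta_t}$ and $\mathring x_{t+1}=\mathcal D_\xi H^\nu(\gamma_t)$ for $t=0,\dots,N-1$; and, for $t=1,\dots,N-1$, $$\rho^{t-1}=\mathrm{Ad}^*_{e^{-\eta_t}}\rho^t+T_e^*\Phi_{\mathring q_t}\big(\mathcal D_qH^\nu(\gamma_t)+\mu^t\mathcal D_qg_t(\mathring q_t,\mathring x_t)\big),\qquad \xi^{t-1}=\mathcal D_xH^\nu(\gamma_t)+\mu^t\mathcal D_xg_t(\mathring q_t,\mathring x_t),$$ where $\langle \mathrm{Ad}_h^*a,\beta\rangle=\langle a,h\beta h^{-1}\rangle$ and $\langle T_e^*\Phi_q a,\chi\rangle=\langle a,q\chi\rangle$; (ii) (transversality) the covector $$\big(T^*_{\mathring q_N}\Phi_{\mathring q_N^{-1}}(\rho^{N-1}),\xi^{N-1}\big)-\nu\,\mathcal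 D_{(q,x)}c_N(\mathring q_N,\mathring x_N)-\mu^N\mathcal D_{(q,x)}g_N(\mathring q_N,\mathring x_N)$$ annihilates $T_{(\mathring q_N,\mathring x_N)}M_{\rm fin}$; (iii) $\langle\mathcal D_uH^\nu(\gamma_t),w-\mathring u_t\rangle\le 0$ for all $w\in\mathbb U_t$ and $t=0,\dots,N-1$; (iv) $\mu^t_j\,g_t^j(\mathring q_t,\mathring x_t)=0$ for all $j=1,\dots,n_g(t)$ and $t=1,\dots,N$; (v) $\mu^t\le 0$ componentwise for $t=1,\dots,N$; (vi) $(\zeta^t,\xi^t)_{t=0}^{N-1}$, $(\mu^t)_{t=1}^{N}$ and $\nu$ do not all vanish. -/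

import Mathlib

noncomputable section

open scoped Manifold ContDiff

namespace DiscretePMP

/-- The real algebra of `m × m` matrices over `𝕜` (`ℝ` or `ℂ`), with its usual topology, given by
an operator norm. -/
def Mat (𝕜 : Type*) [RCLike 𝕜] (m : ℕ) : Type _ := Matrix (Fin m) (Fin m) 𝕜

section Mat

variable {𝕜 : Type*} [RCLike 𝕜] {m : ℕ}

instance : Ring (Mat 𝕜 m) := inferInstanceAs (Ring (Matrix (Fin m) (Fin m) 𝕜))

instance : NormedRing (Mat 𝕜 m) where
  __ := (inferInstance : Ring (Mat 𝕜 m))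
  __ := Matrix.linftyOpNormedRing (n := Fin m) (α := 𝕜)

instance : NormedAlgebra ℝ (Mat 𝕜 m) where
  __ := Matrix.linftyOpNormedAlgebra (n := Fin m) (R := ℝ) (α := 𝕜)

instance : NormedAlgebra ℚ (Mat 𝕜 m) := NormedAlgebra.restrictScalars ℚ ℝ (Mat 𝕜 m)

instance : FiniteDimensional ℝ (Mat 𝕜 m) :=
  inferInstanceAs (Module.Finite ℝ (Matrix (Fin m) (Fin m) 𝕜))

instance : CompleteSpace (Mat 𝕜 m) := FiniteDimensional.complete ℝ (Mat 𝕜 m)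

end Mat

/-- A matrix Lie group: a closed subgroup of `GL(m, 𝕜)`, where `𝕜` is `ℝ` or `ℂ`. -/
structure MatrixLieGroup (𝕜 : Type*) [RCLike 𝕜] (m : ℕ) where
  /-- the underlying subgroup of the general linear group -/
  toSubgroup : Subgroup ((Mat 𝕜 m)ˣ)
  isClosed : IsClosed (toSubgroup : Set ((Mat 𝕜 m)ˣ))

/-- The matrix exponential with values in the general linear group. -/
def expGL {𝕜 : Type*} [RCLike 𝕜] {m : ℕ} (X : Mat 𝕜 m) :
    (Mat 𝕜 m)ˣ where
  val := NormedSpace.exp X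
  inv := NormedSpace.exp (-X)
  val_inv := by
    rw [← NormedSpace.exp_add_of_commute (Commute.refl X).neg_right]; simp
  inv_val := by
    rw [← NormedSpace.exp_add_of_commute (Commute.refl X).neg_left]; simp

namespace MatrixLieGroup

variable {𝕜 : Type*} [RCLike 𝕜] {m : ℕ}

instance : CoeSort (MatrixLieGroup 𝕜 m) (Type _) := ⟨fun G => G.toSubgroup⟩

/-- The matrix of an element of a matrix Lie group. -/
def mat {G : MatrixLieGroup 𝕜 m} (q : G) : Mat 𝕜 m :=
  ((q : (Mat 𝕜 m)ˣ) : Mat 𝕜 m)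

theorem mat_mul {G : MatrixLieGroup 𝕜 m} (p q : G) : mat (p * q) = mat p * mat q := rfl
theorem mat_one {G : MatrixLieGroup 𝕜 m} : mat (1 : G) = 1 := rfl
theorem mat_inv_mul {G : MatrixLieGroup 𝕜 m} (q : G) : mat q⁻¹ * mat q = 1 := by
  rw [← mat_mul, inv_mul_cancel, mat_one]

/-- If a curve in `G` through the identity has velocity `X` there, then `exp (t X) ∈ G`
for all real `t`. -/
theorem expGL_smul_mem_of_hasDerivAt (G : MatrixLieGroup 𝕜 m) {γ : ℝ → G}
    {X : Mat 𝕜 m} (h0 : γ 0 = 1)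
    (h : HasDerivAt (fun s => mat (γ s)) X 0) (t : ℝ) : expGL (t • X) ∈ G.toSubgroup := by
  have hE := hasStrictFDerivAt_exp_zero (𝕂 := ℝ) (𝔸 := Mat 𝕜 m)
  have hE' : HasStrictFDerivAt (NormedSpace.exp : Mat 𝕜 m → _)
    ((ContinuousLinearEquiv.refl ℝ (Mat 𝕜 m) :
      Mat 𝕜 m →L[ℝ] Mat 𝕜 m)) 0 := hE
  set L := hE'.localInverse with hL
  have hLd := hE'.to_localInverse.hasFDerivAt
  have hr := hE'.eventually_right_inverse
  have hL0 := hE'.localInverse_apply_image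
  rw [← hL] at hLd hr hL0
  rw [NormedSpace.exp_zero] at hLd hr hL0
  have hγ0 : mat (γ 0) = 1 := by rw [h0, mat_one]
  have hγ : HasDerivAt (fun s : ℝ => mat (γ (t * s))) (t • X) 0 := by
    have h1 : HasDerivAt (fun s : ℝ => t * s) t 0 := by
      simpa using (hasDerivAt_id (0 : ℝ)).const_mul t
    have h2 : HasDerivAt (fun s => mat (γ s)) X (t * 0) := by simpa using h
    exact h2.scomp (0 : ℝ) h1
  have hδ : HasDerivAt (fun s : ℝ => L (mat (γ (t * s)))) (t • X) 0 := by
    rw [show (1 : Mat 𝕜 m) = mat (γ (t * 0)) by rw [mul_zero, hγ0]] at hLd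
    exact hLd.comp_hasDerivAt (0 : ℝ) hγ
  have hcont : Filter.Tendsto (fun s : ℝ => mat (γ (t * s))) (nhds 0) (nhds 1) := by
    have := hγ.continuousAt.tendsto
    rwa [mul_zero, hγ0] at this
  have hinv : Filter.Tendsto (fun n : ℕ => ((n : ℝ) + 1)⁻¹) Filter.atTop (nhds 0) := by
    simpa [one_div] using tendsto_one_div_add_atTop_nhds_zero_nat (𝕜 := ℝ)
  have hlim : Filter.Tendsto (fun n : ℕ => (n + 1) • L (mat (γ (t * ((n : ℝ) + 1)⁻¹))))
      Filter.atTop (nhds (t • X)) := by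
    have hs := hδ.tendsto_slope
    have hinv' : Filter.Tendsto (fun n : ℕ => ((n : ℝ) + 1)⁻¹) Filter.atTop
        (nhdsWithin 0 {0}ᶜ) := by
      refine tendsto_nhdsWithin_iff.2 ⟨hinv, Filter.Eventually.of_forall fun n => ?_⟩
      have : (0 : ℝ) < (n : ℝ) + 1 := by positivity
      simp [this.ne']
    refine (hs.comp hinv').congr fun n => ?_
    simp only [Function.comp, slope, vsub_eq_sub, sub_zero, inv_inv, mul_zero, hγ0, hL0]
    rw [← Nat.cast_smul_eq_nsmul ℝ]; push_cast; rfl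
  have hexp : Filter.Tendsto (fun n : ℕ => mat (γ (t * ((n : ℝ) + 1)⁻¹) ^ (n + 1)))
      Filter.atTop (nhds (NormedSpace.exp (t • X))) := by
    have hc : Continuous (NormedSpace.exp : Mat 𝕜 m → _) :=
      NormedSpace.exp_continuous
    refine ((hc.tendsto _).comp hlim).congr' ?_
    filter_upwards [(hcont.comp hinv).eventually hr] with n hn
    simp only [Function.comp] at hn ⊢
    rw [NormedSpace.exp_nsmul, hn]; rfl
  have hGL : Filter.Tendsto (fun n : ℕ => ((γ (t * ((n : ℝ) + 1)⁻¹) ^ (n + 1) : G) :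
      (Mat 𝕜 m)ˣ)) Filter.atTop (nhds (expGL (t • X))) :=
    Units.isOpenEmbedding_val.isInducing.tendsto_nhds_iff.2 hexp
  exact G.isClosed.mem_of_tendsto hGL (Filter.Eventually.of_forall fun n => Subtype.property _)


/-- The curve `s ↦ exp (s X)` has velocity `X` at `s = 0`. -/
theorem hasDerivAt_exp_smul_zero (X : Mat 𝕜 m) :
    HasDerivAt (fun s : ℝ => NormedSpace.exp (s • X)) X 0 := by
  simpa using hasDerivAt_exp_smul_const (𝕂 := ℝ) X (0 : ℝ)

/-- The Lie algebra `𝔤` of `G`: the matrices `X` with `exp (t X) ∈ G` for all real `t`. -/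
def lieAlgebra (G : MatrixLieGroup 𝕜 m) : Submodule ℝ (Mat 𝕜 m) where
  carrier := {X | ∀ t : ℝ, expGL (t • X) ∈ G.toSubgroup}
  zero_mem' := fun t => by
    have : expGL (t • (0 : Mat 𝕜 m)) = 1 := by
      ext1; simp [expGL]
    rw [this]; exact one_mem _
  smul_mem' := fun c X hX t => by
    rw [smul_smul]; exact hX _
  add_mem' := fun {X Y} hX hY => by
    refine expGL_smul_mem_of_hasDerivAt G
      (γ := fun s => (⟨expGL (s • X), hX s⟩ : G) * ⟨expGL (s • Y), hY s⟩) ?_ ?_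
    · apply Subtype.ext
      apply Units.ext
      simp [expGL]
    · have h := (hasDerivAt_exp_smul_zero X).mul (hasDerivAt_exp_smul_zero Y)
      simp only [zero_smul, NormedSpace.exp_zero, mul_one, one_mul] at h
      exact h

variable {G : MatrixLieGroup 𝕜 m}

/-- The exponential map `𝔤 → G`. -/
def exp (X : G.lieAlgebra) : G :=
  ⟨expGL (X : Mat 𝕜 m), by simpa using X.2 1⟩

/-- The velocity at the identity of any curve in `G` belongs to `𝔤`. -/
theorem mem_lieAlgebra_of_hasDerivAt {γ : ℝ → G} {X : Mat 𝕜 m}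
    (h0 : γ 0 = 1) (h : HasDerivAt (fun s => mat (γ s)) X 0) : X ∈ G.lieAlgebra :=
  expGL_smul_mem_of_hasDerivAt G h0 h

/-- The adjoint action `Ad_g β = d/ds|₀ g exp(s β) g⁻¹ = g β g⁻¹` of `G` on `𝔤`. -/
def Ad (g : G) : G.lieAlgebra →L[ℝ] G.lieAlgebra :=
  LinearMap.toContinuousLinearMap
    { toFun := fun β : G.lieAlgebra => ⟨mat g * (β.1 : Mat 𝕜 m) * mat g⁻¹, by
        refine mem_lieAlgebra_of_hasDerivAt
          (γ := fun s => g * (⟨expGL (s • (β.1 : Mat 𝕜 m)), β.2 s⟩ : G) * g⁻¹) ?_ ?_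
        · have : (⟨expGL ((0 : ℝ) • (β.1 : Mat 𝕜 m)), β.2 0⟩ : G) = 1 := by
            apply Subtype.ext
            apply Units.ext
            simp [expGL]
          rw [this]; simp
        · exact ((hasDerivAt_exp_smul_zero (β.1 : Mat 𝕜 m)).const_mul
            (mat g)).mul_const (mat g⁻¹)⟩
      map_add' := fun β β' : G.lieAlgebra => Subtype.ext (by simp [mul_add, add_mul])
      map_smul' := fun (c : ℝ) (β : G.lieAlgebra) => Subtype.ext (by simp) }

/-- The dual map `Ad_g^* : 𝔤* → 𝔤*`, `⟨Ad_g^* a, β⟩ = ⟨a, Ad_g β⟩`. -/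
def AdDual (g : G) (a : G.lieAlgebra →L[ℝ] ℝ) : G.lieAlgebra →L[ℝ] ℝ :=
  a ∘L Ad g

theorem mat_mul_inv (q : G) : mat q * mat q⁻¹ = 1 := by
  rw [← mat_mul, mul_inv_cancel, mat_one]

theorem mulLeft_mat_injective (q : G) :
    Function.Injective (LinearMap.mulLeft ℝ (mat q)) := by
  intro X Y h
  have h' : mat q * X = mat q * Y := h
  calc X = mat q⁻¹ * (mat q * X) := by rw [← mul_assoc, mat_inv_mul, one_mul]
    _ = Y := by rw [h', ← mul_assoc, mat_inv_mul, one_mul]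

/-- The tangent space `T_q G = q 𝔤`, as a real subspace of the space of matrices. -/
def tangentSpace (q : G) : Submodule ℝ (Mat 𝕜 m) :=
  G.lieAlgebra.map (LinearMap.mulLeft ℝ (mat q))

/-- The derivative `T_e Φ_q : 𝔤 → T_q G`, `χ ↦ q χ`, of the left translation `Φ_q`. Its inverse
is `T_q Φ_{q⁻¹}`. -/
def leftTranslation (q : G) : G.lieAlgebra ≃L[ℝ] tangentSpace q :=
  (Submodule.equivMapOfInjective (LinearMap.mulLeft ℝ (mat q)) (mulLeft_mat_injective q)
    G.lieAlgebra).toContinuousLinearEquiv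

/-- The cotangent left trivialization `T_e^* Φ_q : T_q^* G → 𝔤*`,
`⟨T_e^* Φ_q a, χ⟩ = ⟨a, T_e Φ_q χ⟩`. -/
def cotangentTriv (q : G) (a : tangentSpace q →L[ℝ] ℝ) : G.lieAlgebra →L[ℝ] ℝ :=
  a ∘L (leftTranslation q : G.lieAlgebra →L[ℝ] tangentSpace q)

/-- The map `T_q^* Φ_{q⁻¹} : 𝔤* → T_q^* G`, inverse to the cotangent left trivialization. -/
def cotangentTrivInv (q : G) (a : G.lieAlgebra →L[ℝ] ℝ) : tangentSpace q →L[ℝ] ℝ :=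
  a ∘L ((leftTranslation q).symm : tangentSpace q →L[ℝ] G.lieAlgebra)

variable {Y : Type*} [NormedAddCommGroup Y] [NormedSpace ℝ Y]

/-- The derivative `D φ(q) : T_q G → Y` of a map `φ : G → Y`, computed in the exponential chart
`χ ↦ q exp χ` centred at `q`, whose derivative at `0` is `T_e Φ_q`. -/
def mderiv (φ : G → Y) (q : G) : tangentSpace q →L[ℝ] Y :=
  (fderiv ℝ (fun χ : G.lieAlgebra => φ (q * exp χ)) 0) ∘L
    ((leftTranslation q).symm : tangentSpace q →L[ℝ] G.lieAlgebra)

variable {X : Type*} [NormedAddCommGroup X] [NormedSpace ℝ X]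

/-- The partial derivative `D_q F(q, x) : T_q G → Y`. -/
def derivQ (F : G × X → Y) (q : G) (x : X) : tangentSpace q →L[ℝ] Y :=
  mderiv (fun q' => F (q', x)) q

/-- The partial derivative `D_x F(q, x) : X → Y`. -/
def derivX (F : G × X → Y) (q : G) (x : X) : X →L[ℝ] Y :=
  fderiv ℝ (fun x' => F (q, x')) x

/-- The derivative `D_{(q,x)} F(q, x) : T_q G × X → Y`. -/
def derivQX (F : G × X → Y) (q : G) (x : X) : tangentSpace q × X →L[ℝ] Y :=
  (derivQ F q x).coprod (derivX F q x)

/-- A map `f` on a subset `S` of an embedded submanifold (with embedding `emb` into a normed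
space `V`) is smooth: near every point of `S` it is the restriction of a smooth map defined on an
open subset of `V`. -/
def IsSmoothOn {A V : Type*} [NormedAddCommGroup V] [NormedSpace ℝ V] (emb : A → V)
    (f : A → Y) (S : Set A) : Prop :=
  ∀ p ∈ S, ∃ U : Set V, IsOpen U ∧ emb p ∈ U ∧ ∃ F : V → Y, ContDiffOn ℝ ∞ F U ∧
    ∀ p' ∈ S, emb p' ∈ U → F (emb p') = f p'

/-- `f : G × X → Y` is smooth, `X` and `Y` being normed spaces. -/
def IsSmooth (f : G × X → Y) : Prop :=
  IsSmoothOn (fun p : G × X => (mat p.1, p.2)) f Set.univ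

/-- The inverse `exp⁻¹ : exp(O) → O` of the exponential map restricted to `O`. -/
def log (O : Set G.lieAlgebra) : G → G.lieAlgebra :=
  Function.invFunOn exp O

/-- `O` is open and `exp : O → exp(O)` is a diffeomorphism onto an open subset of `G`. -/
structure IsExpDiffeo (O : Set G.lieAlgebra) : Prop where
  isOpen : IsOpen O
  injOn : Set.InjOn exp O
  isOpen_image : IsOpen (exp '' O)
  smooth_log : IsSmoothOn mat (log O) (exp '' O)

/-- The derivative at `p` of a map `ι : M → G × X`, with values in the ambient space of
`G × X`. -/
def ambientDeriv {k : ℕ} {M : Type*} [TopologicalSpace M]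
    [ChartedSpace (EuclideanSpace ℝ (Fin k)) M] (ι : M → G × X) (p : M) :
    EuclideanSpace ℝ (Fin k) →L[ℝ] Mat 𝕜 m × X :=
  mfderiv 𝓘(ℝ, EuclideanSpace ℝ (Fin k)) 𝓘(ℝ, Mat 𝕜 m × X)
    (fun p => (mat (ι p).1, (ι p).2)) p

/-- `ι : M → G × X` presents its image as an immersed submanifold of `G × X`, where `M` is a
manifold of dimension `k`: `ι` is an injective smooth immersion. -/
structure IsImmersedSubmanifold {k : ℕ} {M : Type*} [TopologicalSpace M]
    [ChartedSpace (EuclideanSpace ℝ (Fin k)) M] (ι : M → G × X) : Prop where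
  injective : Function.Injective ι
  smooth : ContMDiff 𝓘(ℝ, EuclideanSpace ℝ (Fin k)) 𝓘(ℝ, Mat 𝕜 m × X) ∞
    (fun p => (mat (ι p).1, (ι p).2))
  immersion : ∀ p, Function.Injective (ambientDeriv (k := k) ι p)

/-- The tangent space at `(q, x)` of the immersed submanifold presented by `ι`, as a subset of
`T_q G × X`: the image of the derivative of `ι` at the point over `(q, x)`. -/
def tangentSubmanifold {k : ℕ} {M : Type*} [TopologicalSpace M]
    [ChartedSpace (EuclideanSpace ℝ (Fin k)) M] (ι : M → G × X) (q : G) (x : X) :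
    Set (tangentSpace q × X) :=
  {v | ∃ p, ι p = (q, x) ∧ ∃ w, ambientDeriv (k := k) ι p w = ((v.1 : Mat 𝕜 m), v.2)}

/-- The derivative at `p` of a smooth map `ι : M → G × X` takes values in `T_q G × X`. -/
theorem ambientDeriv_mem {k : ℕ} {M : Type*} [TopologicalSpace M]
    [ChartedSpace (EuclideanSpace ℝ (Fin k)) M]
    [IsManifold 𝓘(ℝ, EuclideanSpace ℝ (Fin k)) ∞ M] {ι : M → G × X}
    (hι : ContMDiff 𝓘(ℝ, EuclideanSpace ℝ (Fin k)) 𝓘(ℝ, Mat 𝕜 m × X) ∞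
      (fun p => (mat (ι p).1, (ι p).2))) (p : M) (w : EuclideanSpace ℝ (Fin k)) :
    (ambientDeriv ι p w).1 ∈ tangentSpace (ι p).1 := by
  have hd := ((hι p).mdifferentiableAt (by simp)).hasMFDerivAt.2
  simp only [writtenInExtChartAt, extChartAt_model_space_eq_id, PartialEquiv.refl_coe,
    Function.id_comp, modelWithCornersSelf_coe, Set.range_id] at hd
  set e := extChartAt 𝓘(ℝ, EuclideanSpace ℝ (Fin k)) p with he
  have hline : HasDerivAt (fun s : ℝ => e p + s • w) w 0 := by
    simpa using ((hasDerivAt_id (0 : ℝ)).smul_const w).const_add (e p)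
  rw [show e p = e p + (0 : ℝ) • w by simp] at hd
  have hc := hd.comp_hasDerivAt (0 : ℝ) hline
  have hc1 : HasDerivAt (fun s : ℝ => mat (ι (e.symm (e p + s • w))).1) (ambientDeriv ι p w).1 0 :=
    (ContinuousLinearMap.fst ℝ (Mat 𝕜 m) X).hasFDerivAt.comp_hasDerivAt (0 : ℝ) (hc (by simp))
  have hmem : mat (ι p).1⁻¹ * (ambientDeriv ι p w).1 ∈ G.lieAlgebra := by
    refine mem_lieAlgebra_of_hasDerivAt
      (γ := fun s => (ι p).1⁻¹ * (ι (e.symm (e p + s • w))).1) ?_ (hc1.const_mul _)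
    simp [he]
  refine ⟨_, hmem, ?_⟩
  rw [LinearMap.mulLeft_apply, ← mul_assoc, mat_mul_inv, one_mul]

end MatrixLieGroup

open MatrixLieGroup

/-- Data of the discrete-time optimal control problem on `G × ℝ^nx` with controls in `ℝ^nu`. Only
the indices `t = 0, …, N - 1` of `s`, `f`, `U`, `c` and `t = 1, …, N` of `g` are used. -/
structure ControlProblem {𝕜 : Type*} [RCLike 𝕜] {m : ℕ} (G : MatrixLieGroup 𝕜 m)
    (nx nu : ℕ) where
  /-- the horizon -/
  N : ℕ
  /-- the dynamics on the group -/
  s : ℕ → G × EuclideanSpace ℝ (Fin nx) → G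
  /-- the dynamics on `ℝ^nx` -/
  f : ℕ → G × EuclideanSpace ℝ (Fin nx) × EuclideanSpace ℝ (Fin nu) → EuclideanSpace ℝ (Fin nx)
  /-- the sets of feasible control actions -/
  U : ℕ → Set (EuclideanSpace ℝ (Fin nu))
  /-- the costs per stage -/
  c : ℕ → G × EuclideanSpace ℝ (Fin nx) × EuclideanSpace ℝ (Fin nu) → ℝ
  /-- the final cost -/
  cN : G × EuclideanSpace ℝ (Fin nx) → ℝ
  /-- the numbers of state constraints -/
  ng : ℕ → ℕ
  /-- the state constraint functions -/
  g : (t : ℕ) → G × EuclideanSpace ℝ (Fin nx) → EuclideanSpace ℝ (Fin (ng t))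
  /-- the initial state on the group -/
  q₀ : G
  /-- the initial state in `ℝ^nx` -/
  x₀ : EuclideanSpace ℝ (Fin nx)

namespace ControlProblem

variable {𝕜 : Type*} [RCLike 𝕜] {m : ℕ} {G : MatrixLieGroup 𝕜 m} {nx nu : ℕ}

/-- The performance index. -/
def cost (P : ControlProblem G nx nu) (q : ℕ → G) (x : ℕ → EuclideanSpace ℝ (Fin nx))
    (u : ℕ → EuclideanSpace ℝ (Fin nu)) : ℝ :=
  ∑ t ∈ Finset.range P.N, P.c t (q t, x t, u t) + P.cN (q P.N, x P.N)

/-- `(q, x, u)` satisfies all constraints of the problem with terminal constraint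
`(q_N, x_N) ∈ Mfin`. -/
structure IsFeasible (P : ControlProblem G nx nu) (Mfin : Set (G × EuclideanSpace ℝ (Fin nx)))
    (q : ℕ → G) (x : ℕ → EuclideanSpace ℝ (Fin nx)) (u : ℕ → EuclideanSpace ℝ (Fin nu)) :
    Prop where
  dyn_q : ∀ t < P.N, q (t + 1) = q t * P.s t (q t, x t)
  dyn_x : ∀ t < P.N, x (t + 1) = P.f t (q t, x t, u t)
  control : ∀ t < P.N, u t ∈ P.U t
  state : ∀ t, 1 ≤ t → t ≤ P.N → ∀ j, P.g t (q t, x t) j ≤ 0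
  init_q : q 0 = P.q₀
  init_x : x 0 = P.x₀
  final : (q P.N, x P.N) ∈ Mfin

/-- The controller `u`, with state trajectory `(q, x)`, solves the problem with terminal
constraint `(q_N, x_N) ∈ Mfin`. -/
def IsOptimal (P : ControlProblem G nx nu) (Mfin : Set (G × EuclideanSpace ℝ (Fin nx)))
    (q : ℕ → G) (x : ℕ → EuclideanSpace ℝ (Fin nx)) (u : ℕ → EuclideanSpace ℝ (Fin nu)) :
    Prop :=
  P.IsFeasible Mfin q x u ∧ ∀ q' x' u', P.IsFeasible Mfin q' x' u' → P.cost q x u ≤ P.cost q' x' u'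

/-- Standing assumptions: smooth data, convex control sets, `exp : O → exp(O)` is a
diffeomorphism, and the integration steps of all feasible trajectories lie in `exp(O)`. -/
structure Assumptions (P : ControlProblem G nx nu) (Mfin : Set (G × EuclideanSpace ℝ (Fin nx)))
    (O : Set G.lieAlgebra) : Prop where
  smooth_s : ∀ t < P.N, IsSmooth (fun p => mat (P.s t p))
  smooth_f : ∀ t < P.N, IsSmooth (P.f t)
  smooth_g : ∀ t, 1 ≤ t → t ≤ P.N → IsSmooth (P.g t)
  smooth_c : ∀ t < P.N, IsSmooth (P.c t)
  smooth_cN : IsSmooth P.cN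
  exp_diffeo : IsExpDiffeo O
  step_mem : ∀ q x u, P.IsFeasible Mfin q x u → ∀ t < P.N, P.s t (q t, x t) ∈ exp '' O
  convex_U : ∀ t < P.N, Convex ℝ (P.U t)

/-- The Hamiltonian
`H^ν(t, ζ, ξ, q, x, u) = ν c_t(q, x, u) + ⟨ζ, exp⁻¹(s_t(q, x))⟩ + ⟨ξ, f_t(q, x, u)⟩`. -/
def hamiltonian (P : ControlProblem G nx nu) (O : Set G.lieAlgebra) (ν : ℝ) (t : ℕ)
    (ζ : G.lieAlgebra →L[ℝ] ℝ) (ξ : EuclideanSpace ℝ (Fin nx) →L[ℝ] ℝ) (q : G)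
    (x : EuclideanSpace ℝ (Fin nx)) (u : EuclideanSpace ℝ (Fin nu)) : ℝ :=
  ν * P.c t (q, x, u) + ζ (log O (P.s t (q, x))) + ξ (P.f t (q, x, u))

end ControlProblem

/-- The derivative at `a` of a function on the dual of a finite-dimensional space `V`, as an
element of `V` under the canonical identification `V ≃ V**`. -/
def derivDual {V : Type*} [NormedAddCommGroup V] [NormedSpace ℝ V]
    (h : (V →L[ℝ] ℝ) → ℝ) (a : V →L[ℝ] ℝ) : V :=
  Function.invFun (NormedSpace.inclusionInDoubleDual ℝ V) (fderiv ℝ h a)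

/-- `ρ = (D exp⁻¹(exp η) ∘ T_e Φ_{exp η})^* ζ ∈ 𝔤*`. -/
def codexp {𝕜 : Type*} [RCLike 𝕜] {m : ℕ} {G : MatrixLieGroup 𝕜 m} (O : Set G.lieAlgebra)
    (η : G.lieAlgebra) (ζ : G.lieAlgebra →L[ℝ] ℝ) : G.lieAlgebra →L[ℝ] ℝ :=
  cotangentTriv (exp η) (ζ ∘L mderiv (log O) (exp η))

end DiscretePMP

end

open DiscretePMP

open scoped Manifold ContDiff

/-!
The principle is a multiplier rule for a finite-dimensional optimization problem, written in
exponential coordinates `q_t = q̊_t exp χ_t` around the optimal trajectory.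

*Multiplier rule.* For a minimum on a convex set `C` under equality and inequality constraints, the
linearized problem sends the cone of feasible directions to a convex cone. If that cone were the
whole space, finitely many feasible directions would yield a right inverse of the derivative of the
equality constraints, and the inverse function theorem would yield a curve of feasible points in `C`
with decreasing cost (`exists_descent`). Hence the cone is not the whole space, and a functional
that is nonnegative on it provides the multipliers (`exists_fritzJohn_multipliers`). Neither
closedness nor interior points of `C` are needed.

*Costates.* All states `z_t`, the controls, and a parameter `v` of the terminal submanifold are kept
as independent variables; the dynamics, the initial condition and the terminal condition `z_N = m v`
are equality constraints. The multipliers of the dynamics are the costates, stationarity with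
respect to `z_t` is the backward recursion, and stationarity with respect to `v` gives
transversality (`exists_costates`). Multipliers of the initial and terminal conditions are determined
by the others, so they do not enter the nontriviality statement.

*Coordinates.* Left translation of the inverse of `exp` on `exp(O)`, composed with a local inverse,
provides a logarithm near the identity of `G` (`IsExpDiffeo.exists_localLog`). With
`p = s_t(q̊_t, x̊_t)` and `σ = log (p⁻¹ s_t)`, a step of the dynamics becomes
`χ ↦ log (exp (Ad_{p⁻¹} χ) exp σ)`, whose derivative is `Ad_{p⁻¹} χ + Dσ`
(`exists_step_coordinates`). The derivative of `exp⁻¹ ∘ s_t` is `Λ_t ∘ Dσ`, where `Λ_t` is the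
derivative of `exp⁻¹` at `p` read in the chart. It is invertible, so that `ζ^t = ρ^t ∘ Λ_t⁻¹`
turns the coordinate recursion into the one with the Hamiltonian.
-/

namespace DiscretePMP

open Filter Topology

/-! ### A Fritz John rule on convex sets -/

/-- A convex cone that is not the whole space lies in a closed half-space. The cone need be neither
closed nor solid. -/
theorem exists_nonneg_functional_of_cone {Y : Type*} [NormedAddCommGroup Y] [NormedSpace ℝ Y]
    [FiniteDimensional ℝ Y] {K : Set Y} (hK : Convex ℝ K) (h0 : (0 : Y) ∈ K)
    (hcone : ∀ r : ℝ, 0 < r → ∀ y ∈ K, r • y ∈ K) (hne : K ≠ Set.univ) :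
    ∃ f : Y →L[ℝ] ℝ, f ≠ 0 ∧ ∀ y ∈ K, 0 ≤ f y := by
  by_cases hspan : Submodule.span ℝ K = ⊤
  · have hint : (interior K).Nonempty := by
      rw [hK.interior_nonempty_iff_affineSpan_eq_top]
      rw [AffineSubspace.affineSpan_eq_top_iff_vectorSpan_eq_top_of_nonempty ℝ Y Y ⟨0, h0⟩,
        vectorSpan_eq_span_vsub_set_right ℝ h0]
      simpa using hspan
    obtain ⟨y, hy⟩ := (Set.ne_univ_iff_exists_notMem K).1 hne
    obtain ⟨f, hf⟩ := geometric_hahn_banach_open_point hK.interior isOpen_interior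
      (fun h => hy (interior_subset h))
    have hle : ∀ a ∈ K, f a ≤ f y := by
      intro a ha
      have hcl : a ∈ closure (interior K) := by
        rw [hK.closure_interior_eq_closure_of_nonempty_interior hint]
        exact subset_closure ha
      exact closure_minimal (t := {a | f a ≤ f y}) (fun b hb => (hf b hb).le)
        (isClosed_le f.continuous continuous_const) hcl
    refine ⟨-f, fun h => ?_, fun a ha => ?_⟩
    · obtain ⟨b, hb⟩ := hint
      have := hf b hb
      rw [neg_eq_zero] at h
      simp [h] at this
    · by_contra hlt
      have hpos : 0 < f a := by simpa using hlt
      have hr : 0 < (|f y| + 1) / f a := by positivity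
      have := hle _ (hcone _ hr a ha)
      rw [map_smul, smul_eq_mul, div_mul_cancel₀ _ hpos.ne'] at this
      linarith [le_abs_self (f y)]
  · obtain ⟨f, hf, hle⟩ := Submodule.exists_le_ker_of_lt_top _ (lt_top_iff_ne_top.2 hspan)
    refine ⟨LinearMap.toContinuousLinearMap f, fun h => hf ?_, fun y hy => ?_⟩
    · ext y; simpa using DFunLike.congr_fun h y
    · exact (show f y = 0 from hle (Submodule.subset_span hy)).ge

theorem add_sum_smul_sub_mem {W κ : Type*} [AddCommGroup W] [Module ℝ W] [Fintype κ]
    {C : Set W} (hC : Convex ℝ C) {w₀ : W} (h₀ : w₀ ∈ C) {w : κ → W} (hw : ∀ j, w j ∈ C)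
    {b : κ → ℝ} (hb : ∀ j, 0 ≤ b j) (hsum : ∑ j, b j ≤ 1) :
    w₀ + ∑ j, b j • (w j - w₀) ∈ C := by
  have := hC.sum_mem (t := Finset.univ) (w := fun o : Option κ => o.elim (1 - ∑ j, b j) b)
    (z := fun o => o.elim w₀ w) (by rintro (_ | j) _ <;> simp [hb, hsum])
    (by simp [Fintype.sum_option]) (by rintro (_ | j) _ <;> simp [h₀, hw])
  convert this using 1
  simp only [Fintype.sum_option, Option.elim, smul_sub, Finset.sum_sub_distrib, sub_smul, one_smul,
    Finset.sum_smul]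
  abel

theorem eventually_lt_of_hasDerivAt_neg {φ : ℝ → ℝ} {a : ℝ} (h : HasDerivAt φ a 0) (ha : a < 0) :
    ∀ᶠ s in 𝓝[>] (0 : ℝ), φ s < φ 0 := by
  have h1 := (hasDerivAt_iff_tendsto_slope.1 h).eventually (gt_mem_nhds ha)
  have h2 : 𝓝[>] (0 : ℝ) ≤ 𝓝[≠] 0 := nhdsWithin_mono _ fun s hs => ne_of_gt hs
  filter_upwards [h2 h1, self_mem_nhdsWithin] with s hs hpos
  rw [slope_def_field, sub_zero] at hs
  have := (div_neg_iff.1 hs)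
  have hpos' : (0:ℝ) < s := hpos
  rcases this with h | h <;> linarith [h.1, h.2]

/-- A direction `d` in the kernel of `h'` is the velocity of a curve in the level set `h = 0`; the
correction of the straight line is taken in the range of a right inverse `B` of `h'`. -/
theorem exists_curve_of_rightInverse {W Z : Type*} [NormedAddCommGroup W] [NormedSpace ℝ W]
    [NormedAddCommGroup Z] [NormedSpace ℝ Z] [CompleteSpace Z] {h : W → Z} {h' : W →L[ℝ] Z}
    {w₀ : W} (hh : HasStrictFDerivAt h h' w₀) (hh0 : h w₀ = 0) {B : Z →L[ℝ] W}
    (hB : ∀ z, h' (B z) = z) {d : W} (hd : h' d = 0) :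
    ∃ ζ : ℝ → Z, ζ 0 = 0 ∧ HasDerivAt ζ 0 0 ∧ ∀ᶠ s in 𝓝 (0 : ℝ), h (w₀ + s • d + B (ζ s)) = 0 := by
  -- the local inverse of `(s, z) ↦ (s, h (w₀ + s • d + B z))`, whose derivative is the identity
  let S : ℝ × Z →L[ℝ] W := (ContinuousLinearMap.toSpanSingleton ℝ d).coprod B
  have hS : HasStrictFDerivAt (fun p : ℝ × Z => w₀ + S p) S 0 :=
    S.hasStrictFDerivAt.const_add w₀
  have hh2 : HasStrictFDerivAt h h' (w₀ + S 0) := by simpa using hh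
  have hΨ : HasStrictFDerivAt (fun p : ℝ × Z => (p.1, h (w₀ + S p)))
      ((ContinuousLinearEquiv.refl ℝ (ℝ × Z) : ℝ × Z →L[ℝ] ℝ × Z)) 0 := by
    have h1 := (hasStrictFDerivAt_fst (𝕜 := ℝ) (p := (0 : ℝ × Z))).prodMk (hh2.comp 0 hS)
    refine h1.congr_fderiv ?_
    ext p <;> simp [S, hd, hB]
  set Θ := hΨ.localInverse with hΘ
  have hr := hΨ.eventually_right_inverse
  have hd' := hΨ.to_localInverse.hasFDerivAt
  have h0 := hΨ.localInverse_apply_image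
  rw [← hΘ] at hr hd' h0
  have e0 : ((0 : ℝ × Z).1, h (w₀ + S 0)) = (0 : ℝ × Z) := by simp [hh0]
  rw [e0] at hr hd' h0
  have hl : HasDerivAt (fun s : ℝ => ((s, 0) : ℝ × Z)) (1, 0) 0 :=
    (hasDerivAt_id (0 : ℝ)).prodMk (hasDerivAt_const _ _)
  refine ⟨fun s => (Θ (s, 0)).2, ?_, ?_, ?_⟩
  · show (Θ 0).2 = 0
    rw [h0]; rfl
  · have h2 : HasFDerivAt Θ _ ((0 : ℝ), (0 : Z)) := hd'
    have h3 := (ContinuousLinearMap.snd ℝ ℝ Z).hasFDerivAt.comp_hasDerivAt (0 : ℝ)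
      (h2.comp_hasDerivAt (0 : ℝ) hl)
    exact h3.congr_deriv (by simp)
  · have hc : Tendsto (fun s : ℝ => ((s, 0) : ℝ × Z)) (𝓝 0) (𝓝 0) := hl.continuousAt.tendsto
    filter_upwards [hc.eventually hr] with s hs
    have h1 : (Θ (s, 0)).1 = s := congrArg Prod.fst hs
    have h2 : h (w₀ + S (Θ (s, 0))) = 0 := congrArg Prod.snd hs
    simpa [S, h1, add_assoc] using h2

/-- The cone of feasible directions `r • (w - w₀)`, `r ≥ 0`, `w ∈ C`, of a set `C` at `w₀`. -/
def directionCone {W : Type*} [AddCommGroup W] [Module ℝ W] (C : Set W) (w₀ : W) : Set W :=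
  {d | ∃ r : ℝ, 0 ≤ r ∧ ∃ w ∈ C, d = r • (w - w₀)}

section DirectionCone

variable {W : Type*} [AddCommGroup W] [Module ℝ W] {C : Set W} {w₀ : W}

theorem zero_mem_directionCone (h₀ : w₀ ∈ C) : (0 : W) ∈ directionCone C w₀ :=
  ⟨0, le_rfl, w₀, h₀, by simp⟩

theorem sub_mem_directionCone {w : W} (hw : w ∈ C) : w - w₀ ∈ directionCone C w₀ :=
  ⟨1, zero_le_one, w, hw, by simp⟩

theorem smul_mem_directionCone {d : W} (hd : d ∈ directionCone C w₀) {a : ℝ} (ha : 0 ≤ a) :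
    a • d ∈ directionCone C w₀ := by
  obtain ⟨r, hr, w, hw, rfl⟩ := hd
  exact ⟨a * r, by positivity, w, hw, by rw [smul_smul]⟩

theorem add_mem_directionCone (hC : Convex ℝ C) {d e : W}
    (hd : d ∈ directionCone C w₀) (he : e ∈ directionCone C w₀) : d + e ∈ directionCone C w₀ := by
  obtain ⟨r, hr, w, hw, rfl⟩ := hd
  obtain ⟨s, hs, v, hv, rfl⟩ := he
  rcases (add_nonneg hr hs).eq_or_lt with h | h
  · obtain rfl : r = 0 := by linarith
    obtain rfl : s = 0 := by linarith
    exact ⟨0, le_rfl, w, hw, by simp⟩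
  · refine ⟨r + s, h.le, (r / (r + s)) • w + (s / (r + s)) • v, hC hw hv (by positivity)
      (by positivity) (by field_simp), ?_⟩
    have h1 : (r + s) * (r / (r + s)) = r := by field_simp
    have h2 : (r + s) * (s / (r + s)) = s := by field_simp
    rw [smul_sub (r + s), smul_add, smul_smul, smul_smul, h1, h2, add_smul, smul_sub, smul_sub]
    abel

end DirectionCone

/-- If the linearized problem can be solved in the cone of feasible directions for all right-hand
sides, then feasible points with a smaller value of `J` accumulate at `w₀`. -/
theorem exists_descent {W Z ι : Type*} [NormedAddCommGroup W] [NormedSpace ℝ W]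
    [NormedAddCommGroup Z] [NormedSpace ℝ Z] [FiniteDimensional ℝ Z] [Finite ι]
    {C : Set W} (hC : Convex ℝ C) {w₀ : W} (h₀ : w₀ ∈ C)
    {J : W → ℝ} {J' : W →L[ℝ] ℝ} (hJ : HasStrictFDerivAt J J' w₀)
    {g : ι → W → ℝ} {g' : ι → W →L[ℝ] ℝ} (hg : ∀ i, HasStrictFDerivAt (g i) (g' i) w₀)
    {h : W → Z} {h' : W →L[ℝ] Z} (hh : HasStrictFDerivAt h h' w₀)
    (hg0 : ∀ i, g i w₀ ≤ 0) (hh0 : h w₀ = 0)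
    (hsolve : ∀ (a : ℝ) (b : ι → ℝ) (z : Z), ∃ d ∈ directionCone C w₀, J' d ≤ a ∧
      (∀ i, g i w₀ = 0 → g' i d ≤ b i) ∧ h' d = z) :
    ∃ᶠ w in 𝓝 w₀, w ∈ C ∧ (∀ i, g i w ≤ 0) ∧ h w = 0 ∧ J w < J w₀ := by
  have : CompleteSpace Z := FiniteDimensional.complete ℝ Z
  let e := Module.finBasis ℝ Z
  have hlift : ∀ j, ∃ d ∈ directionCone C w₀, h' d = e j := fun j => by
    obtain ⟨d, hd, -, -, h1⟩ := hsolve 0 0 (e j)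
    exact ⟨d, hd, h1⟩
  choose D hD hDe using hlift
  let B : Z →L[ℝ] W := LinearMap.toContinuousLinearMap (e.constr ℝ D)
  have hB : ∀ z, h' (B z) = z := by
    have : (h' : W →ₗ[ℝ] Z) ∘ₗ (e.constr ℝ D) = LinearMap.id :=
      e.ext fun j => by simp [hDe]
    exact fun z => DFunLike.congr_fun this z
  have hBsum : ∀ z, B z = ∑ j, e.repr z j • D j := fun z => e.constr_apply_fintype ℝ D z
  -- the summand `∑ j, D j` makes all coefficients of the perturbed direction positive
  obtain ⟨d, hd, hdJ, hdg, hdh⟩ := hsolve (-1 - J' (∑ j, D j)) (fun i => -1 - g' i (∑ j, D j))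
    (-h' (∑ j, D j))
  set d' := d + ∑ j, D j with hd'
  have hd'J : J' d' < 0 := by rw [hd', map_add]; linarith
  have hd'g : ∀ i, g i w₀ = 0 → g' i d' < 0 := fun i hi => by
    rw [hd', map_add]; linarith [hdg i hi]
  have hd'h : h' d' = 0 := by rw [hd', map_add, hdh]; simp
  obtain ⟨ζ, ζ0, hζ, hζh⟩ := exists_curve_of_rightInverse hh hh0 hB hd'h
  set γ : ℝ → W := fun s => w₀ + s • d' + B (ζ s) with hγ
  have γ0 : γ 0 = w₀ := by simp [hγ, ζ0]
  have hγd : HasDerivAt γ d' 0 := by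
    have h1 : HasDerivAt (fun s : ℝ => w₀ + s • d') d' 0 := by
      simpa using ((hasDerivAt_id (0 : ℝ)).smul_const d').const_add w₀
    have h2 := h1.add (B.hasFDerivAt.comp_hasDerivAt (0 : ℝ) hζ)
    exact h2.congr_deriv (by simp)
  have hγc : Tendsto γ (𝓝[>] 0) (𝓝 w₀) := by
    have := hγd.continuousAt.tendsto
    rw [γ0] at this
    exact this.mono_left nhdsWithin_le_nhds
  have hdir : ∀ {φ : W → ℝ} {φ' : W →L[ℝ] ℝ}, HasStrictFDerivAt φ φ' w₀ → φ' d' < 0 →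
      ∀ᶠ s in 𝓝[>] (0 : ℝ), φ (γ s) < φ w₀ := by
    intro φ φ' hφ hneg
    have h1 : HasFDerivAt φ φ' (γ 0) := γ0.symm ▸ hφ.hasFDerivAt
    have := eventually_lt_of_hasDerivAt_neg (h1.comp_hasDerivAt (0 : ℝ) hγd) hneg
    simpa [γ0] using this
  have hgle : ∀ i, ∀ᶠ s in 𝓝[>] (0 : ℝ), g i (γ s) ≤ 0 := by
    intro i
    rcases (hg0 i).eq_or_lt with hi | hi
    · filter_upwards [hdir (hg i) (hd'g i hi)] with s hs
      exact (hs.trans_eq hi).le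
    · filter_upwards [hγc.eventually ((hg i).hasFDerivAt.continuousAt.eventually (gt_mem_nhds hi))]
        with s hs using hs.le
  -- the curve `γ` stays in `C`
  have hmem : ∀ᶠ s in 𝓝[>] (0 : ℝ), γ s ∈ C := by
    obtain ⟨r₀, hr₀, v₀, hv₀, rfl⟩ := hd
    choose r hr v hv hDr using hD
    have hcoef : ∀ j, HasDerivAt (fun s => e.repr (ζ s) j) 0 0 := fun j => by
      have := (LinearMap.toContinuousLinearMap (e.coord j)).hasFDerivAt.comp_hasDerivAt (0 : ℝ) hζ
      exact this.congr_deriv (by simp)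
    have hpos : ∀ᶠ s in 𝓝[>] (0 : ℝ), ∀ j, 0 ≤ s + e.repr (ζ s) j := by
      refine eventually_all.2 fun j => ?_
      have := eventually_lt_of_hasDerivAt_neg (((hasDerivAt_id (0 : ℝ)).add (hcoef j)).neg)
        (by norm_num)
      filter_upwards [this] with s hs
      simp [ζ0] at hs
      linarith
    have hsmall : ∀ᶠ s in 𝓝[>] (0 : ℝ), s * r₀ + ∑ j, (s + e.repr (ζ s) j) * r j ≤ 1 := by
      have hc : ContinuousAt (fun s => s * r₀ + ∑ j, (s + e.repr (ζ s) j) * r j) 0 := by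
        have := fun j => (hcoef j).continuousAt
        fun_prop
      have h1 : (0 : ℝ) * r₀ + ∑ j, (0 + e.repr (ζ 0) j) * r j < 1 := by simp [ζ0]
      filter_upwards [nhdsWithin_le_nhds (hc.eventually (gt_mem_nhds h1))] with s hs using hs.le
    filter_upwards [hpos, hsmall, self_mem_nhdsWithin] with s h1 h2 h3
    have h3' : (0 : ℝ) < s := h3
    have := add_sum_smul_sub_mem (κ := Option (Fin (Module.finrank ℝ Z))) hC h₀
      (w := fun o => o.elim v₀ v)
      (b := fun o => o.elim (s * r₀) fun j => (s + e.repr (ζ s) j) * r j)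
      (by rintro (_ | j) <;> simp [hv₀, hv])
      (by rintro (_ | j) <;> simp <;> [positivity; exact mul_nonneg (h1 j) (hr j)])
      (by simpa [Fintype.sum_option] using h2)
    convert this using 1
    simp only [hγ, hd', hBsum, Fintype.sum_option, Option.elim, smul_add, mul_smul, ← hDr,
      Finset.smul_sum, add_smul, Finset.sum_add_distrib]
    abel
  refine hγc.frequently (Eventually.frequently ?_)
  filter_upwards [hmem, eventually_all.2 hgle, nhdsWithin_le_nhds hζh, hdir hJ hd'J]
    with s h1 h2 h3 h4 using ⟨h1, h2, h3, h4⟩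

/-- The Fritz John conditions on a convex set `C`: necessary conditions for a local minimum of `J`
on `C` under finitely many equality and inequality constraints. The multiplier `a` of `J` is
normalized to `0` or `1`. -/
theorem exists_fritzJohn_multipliers {W Z ι : Type*} [NormedAddCommGroup W] [NormedSpace ℝ W]
    [NormedAddCommGroup Z] [NormedSpace ℝ Z] [FiniteDimensional ℝ Z] [Fintype ι]
    {C : Set W} (hC : Convex ℝ C) {w₀ : W} (h₀ : w₀ ∈ C)
    {J : W → ℝ} {J' : W →L[ℝ] ℝ} (hJ : HasStrictFDerivAt J J' w₀)
    {g : ι → W → ℝ} {g' : ι → W →L[ℝ] ℝ} (hg : ∀ i, HasStrictFDerivAt (g i) (g' i) w₀)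
    {h : W → Z} {h' : W →L[ℝ] Z} (hh : HasStrictFDerivAt h h' w₀)
    (hg0 : ∀ i, g i w₀ ≤ 0) (hh0 : h w₀ = 0)
    (hopt : ∀ᶠ w in 𝓝 w₀, w ∈ C → (∀ i, g i w ≤ 0) → h w = 0 → J w₀ ≤ J w) :
    ∃ (a : ℝ) (b : ι → ℝ) (l : Z →L[ℝ] ℝ), (a = 1 ∨ a = 0) ∧ (∀ i, 0 ≤ b i) ∧
      (∀ i, b i * g i w₀ = 0) ∧ ¬ (a = 0 ∧ b = 0 ∧ l = 0) ∧
      ∀ w ∈ C, 0 ≤ a * J' (w - w₀) + ∑ i, b i * g' i (w - w₀) + l (h' (w - w₀)) := by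
  classical
  -- the components of inactive constraints are left free, so that their multipliers vanish
  let K : Set (ℝ × (ι → ℝ) × Z) := {y | ∃ d ∈ directionCone C w₀, J' d ≤ y.1 ∧
      (∀ i, g i w₀ = 0 → g' i d ≤ y.2.1 i) ∧ h' d = y.2.2}
  have hKadd : ∀ y ∈ K, ∀ y' ∈ K, y + y' ∈ K := by
    rintro y ⟨d, hd, h1, h2, h3⟩ y' ⟨d', hd', h1', h2', h3'⟩
    refine ⟨d + d', add_mem_directionCone hC hd hd', ?_, fun i hi => ?_, ?_⟩
    · rw [map_add]; exact add_le_add h1 h1'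
    · rw [map_add]; exact add_le_add (h2 i hi) (h2' i hi)
    · rw [map_add, h3, h3']; rfl
  have hKsmul : ∀ r : ℝ, 0 ≤ r → ∀ y ∈ K, r • y ∈ K := by
    rintro r hr y ⟨d, hd, h1, h2, h3⟩
    refine ⟨r • d, smul_mem_directionCone hd hr, ?_, fun i hi => ?_, ?_⟩
    · rw [map_smul]; exact mul_le_mul_of_nonneg_left h1 hr
    · rw [map_smul]; exact mul_le_mul_of_nonneg_left (h2 i hi) hr
    · rw [map_smul, h3]; rfl
  have hKne : K ≠ Set.univ := by
    intro hK
    refine (exists_descent hC h₀ hJ hg hh hg0 hh0 fun a b z => ?_).and_eventually hopt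
      |>.exists.elim ?_
    · have : ((a, b, z) : ℝ × (ι → ℝ) × Z) ∈ K := hK ▸ Set.mem_univ _
      exact this
    · rintro w ⟨⟨h1, h2, h3, h4⟩, h5⟩
      exact absurd (h5 h1 h2 h3) (not_le.2 h4)
  have hmemK : ∀ d ∈ directionCone C w₀, ∀ r : ℝ, 0 ≤ r → ∀ s : ι → ℝ,
      (∀ i, g i w₀ = 0 → 0 ≤ s i) → (J' d + r, (fun i => g' i d + s i), h' d) ∈ K :=
    fun d hd r hr s hs => ⟨d, hd, by simpa using hr, fun i hi => by simpa using hs i hi, rfl⟩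
  have h0d := zero_mem_directionCone h₀
  obtain ⟨f, hf, hfK⟩ := exists_nonneg_functional_of_cone
    (fun y hy y' hy' r s hr hs _ => hKadd _ (hKsmul r hr y hy) _ (hKsmul s hs y' hy'))
    (by simpa [funext_iff, Prod.zero_eq_mk, Pi.zero_def] using hmemK 0 h0d 0 le_rfl 0 (by simp))
    (fun r hr => hKsmul r hr.le) hKne
  let b : ι → ℝ := fun i => f (0, Pi.single i 1, 0)
  let l : Z →L[ℝ] ℝ := f ∘L (ContinuousLinearMap.inr ℝ ℝ ((ι → ℝ) × Z)) ∘L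
    (ContinuousLinearMap.inr ℝ (ι → ℝ) Z)
  have hf_apply : ∀ y : ℝ × (ι → ℝ) × Z, f y = f (1, 0, 0) * y.1 + ∑ i, b i * y.2.1 i + l y.2.2 := by
    rintro ⟨r, s, z⟩
    have : ((r, s, z) : ℝ × (ι → ℝ) × Z) = r • (1, 0, 0) +
        ∑ i, s i • ((0, Pi.single i 1, 0) : ℝ × (ι → ℝ) × Z) + (0, 0, z) := by
      refine Prod.ext ?_ (Prod.ext ?_ ?_)
      · simp [Prod.fst_sum]
      · ext j; simp [Prod.fst_sum, Prod.snd_sum, Finset.sum_apply, Pi.single_apply]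
      · simp [Prod.snd_sum]
    rw [this, map_add, map_add, map_sum, map_smul]
    simp only [map_smul, smul_eq_mul]
    simp [l, b, Prod.fst_sum, Prod.snd_sum, Finset.sum_apply, Pi.single_apply, mul_comm]
  have ha : 0 ≤ f (1, 0, 0) := by
    simpa [Prod.zero_eq_mk, Pi.zero_def] using
      hfK _ (hmemK 0 h0d 1 zero_le_one 0 (by simp))
  have hb : ∀ i, 0 ≤ b i := fun i => by
    have := hfK _ (hmemK 0 h0d 0 le_rfl (Pi.single i 1) fun j _ => by
      by_cases h : j = i <;> simp [h])
    simpa using this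
  suffices hmult : ∃ (a : ℝ) (b : ι → ℝ) (l : Z →L[ℝ] ℝ), 0 ≤ a ∧ (∀ i, 0 ≤ b i) ∧
      (∀ i, b i * g i w₀ = 0) ∧ ¬ (a = 0 ∧ b = 0 ∧ l = 0) ∧
      ∀ w ∈ C, 0 ≤ a * J' (w - w₀) + ∑ i, b i * g' i (w - w₀) + l (h' (w - w₀)) by
    obtain ⟨a, b, l, ha, hb, hbg, hne, hstat⟩ := hmult
    rcases ha.eq_or_lt with rfl | ha
    · exact ⟨0, b, l, Or.inr rfl, hb, hbg, hne, hstat⟩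
    · refine ⟨1, a⁻¹ • b, a⁻¹ • l, Or.inl rfl, fun i => ?_, fun i => ?_, by simp, fun w hw => ?_⟩
      · exact mul_nonneg (inv_nonneg.2 ha.le) (hb i)
      · simp [mul_assoc, hbg i]
      · have := mul_nonneg (inv_nonneg.2 ha.le) (hstat w hw)
        simpa [mul_add, Finset.mul_sum, mul_assoc, inv_mul_cancel_left₀ ha.ne'] using this
  refine ⟨f (1, 0, 0), b, l, ha, hb, fun i => ?_, ?_, fun w hw => ?_⟩
  · by_cases hi : g i w₀ = 0
    · rw [hi, mul_zero]
    · have := hfK _ (hmemK 0 h0d 0 le_rfl (-Pi.single i 1) fun j hj => by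
        have : j ≠ i := fun h => hi (h ▸ hj)
        simp [this])
      have h2 : f (0, -Pi.single i 1, 0) = - b i := by
        rw [← map_neg]; simp
      simp only [map_zero, zero_add, add_zero, ← Pi.neg_apply] at this
      have h3 : b i = 0 := le_antisymm (by
        have h4 : 0 ≤ f (0, -Pi.single i 1, 0) := this
        linarith) (hb i)
      rw [h3, zero_mul]
  · rintro ⟨h1, h2, h3⟩
    refine hf (ContinuousLinearMap.ext fun y => ?_)
    rw [hf_apply, h1, h2, h3]; simp
  · have := hfK _ (hmemK _ (sub_mem_directionCone hw) 0 le_rfl 0 (by simp))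
    rw [hf_apply] at this
    simpa using this

/-! ### The maximum principle in a normed space -/

theorem hasStrictFDerivAt_comp_clm {W E F : Type*} [NormedAddCommGroup W] [NormedSpace ℝ W]
    [NormedAddCommGroup E] [NormedSpace ℝ E] [NormedAddCommGroup F] [NormedSpace ℝ F]
    {φ : E → F} {φ' : E →L[ℝ] F} {w : W} (π : W →L[ℝ] E) {e : E} (he : π w = e)
    (h : HasStrictFDerivAt φ φ' e) : HasStrictFDerivAt (fun w => φ (π w)) (φ' ∘L π) w := by
  subst he
  exact h.comp w π.hasStrictFDerivAt

section Costates

variable {Z U V : Type*} [NormedAddCommGroup Z] [NormedSpace ℝ Z] [FiniteDimensional ℝ Z]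
  [NormedAddCommGroup U] [NormedSpace ℝ U] [NormedAddCommGroup V] [NormedSpace ℝ V]

/-- Multiplier rule for a discrete-time optimal control problem in a normed space, in which all
states are kept as variables and the dynamics, the initial and the final condition are equality
constraints, with multipliers `p t`, `l₀` and `l₁`. -/
theorem exists_control_multipliers {N : ℕ}
    {Φ : ℕ → Z × U → Z} {Φ' : ℕ → Z × U →L[ℝ] Z} {c : ℕ → Z × U → ℝ} {c' : ℕ → Z × U →L[ℝ] ℝ}
    {cN : Z → ℝ} {cN' : Z →L[ℝ] ℝ} {n : ℕ → ℕ} {g : (t : ℕ) → Fin (n t) → Z → ℝ}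
    {g' : (t : ℕ) → Fin (n t) → Z →L[ℝ] ℝ} {m : V → Z} {m' : V →L[ℝ] Z}
    {z₀ : ℕ → Z} {u₀ : ℕ → U} {v₀ : V} {S : ℕ → Set U}
    (hS : ∀ t < N, Convex ℝ (S t))
    (hΦ : ∀ t < N, HasStrictFDerivAt (Φ t) (Φ' t) (z₀ t, u₀ t))
    (hc : ∀ t < N, HasStrictFDerivAt (c t) (c' t) (z₀ t, u₀ t))
    (hcN : HasStrictFDerivAt cN cN' (z₀ N))
    (hg : ∀ t < N, ∀ j, HasStrictFDerivAt (g (t + 1) j) (g' (t + 1) j) (z₀ (t + 1)))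
    (hm : HasStrictFDerivAt m m' v₀)
    (hdyn : ∀ t < N, z₀ (t + 1) = Φ t (z₀ t, u₀ t)) (hu : ∀ t < N, u₀ t ∈ S t)
    (hg0 : ∀ t < N, ∀ j, g (t + 1) j (z₀ (t + 1)) ≤ 0) (hfin : z₀ N = m v₀)
    {B : ℕ → Set Z} (hB : ∀ t ≤ N, B t ∈ 𝓝 (z₀ t)) {B' : Set V} (hB' : B' ∈ 𝓝 v₀)
    (hopt : ∀ (z : ℕ → Z) (u : ℕ → U), ∀ v ∈ B', (∀ t ≤ N, z t ∈ B t) → (∀ t < N, u t ∈ S t) →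
      (∀ t < N, z (t + 1) = Φ t (z t, u t)) → z 0 = z₀ 0 → z N = m v →
      (∀ t < N, ∀ j, g (t + 1) j (z (t + 1)) ≤ 0) →
      ∑ t ∈ Finset.range N, c t (z₀ t, u₀ t) + cN (z₀ N) ≤
        ∑ t ∈ Finset.range N, c t (z t, u t) + cN (z N)) :
    ∃ (a : ℝ) (b : (t : ℕ) → Fin (n t) → ℝ) (p : ℕ → Z →L[ℝ] ℝ) (l₀ l₁ : Z →L[ℝ] ℝ),
      (a = 1 ∨ a = 0) ∧ (∀ t < N, ∀ j, 0 ≤ b (t + 1) j) ∧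
      (∀ t < N, ∀ j, b (t + 1) j * g (t + 1) j (z₀ (t + 1)) = 0) ∧
      ¬ (a = 0 ∧ (∀ t < N, b (t + 1) = 0) ∧ (∀ t < N, p t = 0) ∧ l₀ = 0 ∧ l₁ = 0) ∧
      ∀ (z : ℕ → Z) (u : ℕ → U) (v : V), (∀ t < N, u t ∈ S t) →
        0 ≤ a * (∑ t ∈ Finset.range N, c' t (z t, u t - u₀ t) + cN' (z N)) +
          ∑ t ∈ Finset.range N, ∑ j, b (t + 1) j * g' (t + 1) j (z (t + 1)) +
          ∑ t ∈ Finset.range N, p t (z (t + 1) - Φ' t (z t, u t - u₀ t)) + l₀ (z 0) +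
          l₁ (z N - m' v) := by
  classical
  let W := (Fin (N + 1) → Z) × (Fin N → U) × V
  let πz : Fin (N + 1) → W →L[ℝ] Z := fun i =>
    ContinuousLinearMap.proj i ∘L ContinuousLinearMap.fst ℝ _ _
  let πu : Fin N → W →L[ℝ] U := fun i => ContinuousLinearMap.proj i ∘L
    ContinuousLinearMap.fst ℝ _ _ ∘L ContinuousLinearMap.snd ℝ _ _
  let πv : W →L[ℝ] V := ContinuousLinearMap.snd ℝ _ _ ∘L ContinuousLinearMap.snd ℝ _ _
  let π : Fin N → W →L[ℝ] Z × U := fun t => (πz t.castSucc).prod (πu t)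
  let w₀ : W := (fun i => z₀ i, fun i => u₀ i, v₀)
  have hπz : ∀ i w, πz i w = w.1 i := fun _ _ => rfl
  have hπv : ∀ w, πv w = w.2.2 := fun _ => rfl
  have hπt : ∀ t w, π t w = (w.1 t.castSucc, w.2.1 t) := fun _ _ => rfl
  let C : Set W := {w | ∀ t : Fin N, w.2.1 t ∈ S t}
  have hC : Convex ℝ C := fun w hw w' hw' r s hr hs hrs t => hS t t.2 (hw t) (hw' t) hr hs hrs
  let J : W → ℝ := fun w => ∑ t : Fin N, c t (π t w) + cN (πz (Fin.last N) w)
  have hJ : HasStrictFDerivAt J (∑ t : Fin N, c' t ∘L π t + cN' ∘L πz (Fin.last N)) w₀ :=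
    (HasStrictFDerivAt.fun_sum fun t _ => hasStrictFDerivAt_comp_clm (π t) rfl (hc t t.2)).add
      (hasStrictFDerivAt_comp_clm (πz (Fin.last N)) rfl hcN)
  let γ : (Σ t : Fin N, Fin (n (t + 1))) → W → ℝ := fun i w => g (i.1 + 1) i.2 (πz i.1.succ w)
  have hγ : ∀ i, HasStrictFDerivAt (γ i) (g' (i.1 + 1) i.2 ∘L πz i.1.succ) w₀ := fun i =>
    hasStrictFDerivAt_comp_clm (πz i.1.succ) rfl (hg i.1 i.1.2 i.2)
  let h : W → (Fin N → Z) × Z × Z := fun w =>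
    (fun t => πz t.succ w - Φ t (π t w), πz 0 w - z₀ 0, πz (Fin.last N) w - m (πv w))
  have hh : HasStrictFDerivAt h
      ((ContinuousLinearMap.pi fun t : Fin N => πz t.succ - Φ' t ∘L π t).prod
      ((πz 0).prod (πz (Fin.last N) - m' ∘L πv))) w₀ := by
    refine HasStrictFDerivAt.prodMk (hasStrictFDerivAt_pi.2 fun t => ?_)
      (HasStrictFDerivAt.prodMk ?_ ?_)
    · exact (πz t.succ).hasStrictFDerivAt.sub (hasStrictFDerivAt_comp_clm (π t) rfl (hΦ t t.2))
    · exact (πz 0).hasStrictFDerivAt.sub_const _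
    · exact (πz (Fin.last N)).hasStrictFDerivAt.sub (hasStrictFDerivAt_comp_clm πv rfl hm)
  have hnhds : ∀ᶠ w in 𝓝 w₀, (∀ t : Fin (N + 1), πz t w ∈ B t) ∧ πv w ∈ B' := by
    refine (eventually_all.2 fun t => ?_).and ?_
    · exact (πz t).continuous.continuousAt.eventually (hB t (Nat.lt_succ_iff.1 t.2))
    · exact πv.continuous.continuousAt.eventually hB'
  obtain ⟨a, b, l, ha, hb, hbg, hne, hstat⟩ := exists_fritzJohn_multipliers hC (w₀ := w₀)
    (fun t => hu t t.2) hJ hγ hh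
    (fun i => by simpa [γ, hπz, w₀] using hg0 i.1 i.1.2 i.2)
    (by
      refine Prod.ext (funext fun t => ?_) (Prod.ext ?_ ?_)
      · simpa [h, hπz, hπt, w₀, sub_eq_zero] using hdyn t t.2
      · simp [h, hπz, w₀]
      · simpa [h, hπz, hπv, w₀, sub_eq_zero] using hfin)
    (by
      filter_upwards [hnhds] with w hw hwC hwg hwh
      have h1 := congrArg Prod.fst hwh
      have h2 := congrArg (fun y => y.2.1) hwh
      have h3 := congrArg (fun y => y.2.2) hwh
      let z : ℕ → Z := fun t => if ht : t < N + 1 then w.1 ⟨t, ht⟩ else 0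
      let u : ℕ → U := fun t => if ht : t < N then w.2.1 ⟨t, ht⟩ else 0
      have hz : ∀ t : ℕ, ∀ ht : t < N + 1, z t = w.1 ⟨t, ht⟩ := fun t ht => dif_pos ht
      have hu' : ∀ t : ℕ, ∀ ht : t < N, u t = w.2.1 ⟨t, ht⟩ := fun t ht => dif_pos ht
      have hπ : ∀ t : Fin N, π t w = (z t, u t) := fun t => by
        rw [hz t (by omega), hu' t t.2]; rfl
      have hπs : ∀ t : Fin N, πz t.succ w = z (t + 1) := fun t => by
        rw [hz (t + 1) (by omega)]; rfl
      have hπl : πz (Fin.last N) w = z N := by rw [hz N (by omega)]; rfl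
      have hπ0 : πz 0 w = z 0 := by rw [hz 0 (by omega)]; rfl
      have key := hopt z u (πv w) hw.2 ?_ ?_ ?_ ?_ ?_ ?_
      · simp only [Finset.sum_range] at key
        simp only [J, hπ, hπl]
        exact key
      · intro t ht
        rw [hz t (by omega)]
        exact hw.1 ⟨t, by omega⟩
      · intro t ht
        rw [hu' t ht]
        exact hwC ⟨t, ht⟩
      · intro t ht
        have := congrFun h1 ⟨t, ht⟩
        simp only [h, hπ, hπs, Prod.fst_zero, Pi.zero_apply, sub_eq_zero] at this
        exact this
      · simpa [h, hπ0, sub_eq_zero] using h2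
      · simpa [h, hπl, sub_eq_zero] using h3
      · intro t ht j
        have := hwg ⟨⟨t, ht⟩, j⟩
        simpa only [γ, hπs] using this)
  let p : ℕ → Z →L[ℝ] ℝ := fun t => if ht : t < N then
    l ∘L ContinuousLinearMap.inl ℝ _ _ ∘L ContinuousLinearMap.single ℝ (fun _ => Z) ⟨t, ht⟩ else 0
  let l₀ : Z →L[ℝ] ℝ := l ∘L ContinuousLinearMap.inr ℝ _ _ ∘L ContinuousLinearMap.inl ℝ _ _
  let l₁ : Z →L[ℝ] ℝ := l ∘L ContinuousLinearMap.inr ℝ _ _ ∘L ContinuousLinearMap.inr ℝ _ _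
  have hl : ∀ y : (Fin N → Z) × Z × Z, l y = ∑ t : Fin N, p t (y.1 t) + l₀ y.2.1 + l₁ y.2.2 := by
    rintro ⟨y, e, e'⟩
    have : ((y, e, e') : (Fin N → Z) × Z × Z) =
        ∑ t, (Pi.single t (y t), (0 : Z × Z)) + (0, e, 0) + (0, 0, e') := by
      refine Prod.ext ?_ (Prod.ext ?_ ?_)
      · ext j; simp [Prod.fst_sum, Finset.sum_apply, Pi.single_apply]
      · simp [Prod.snd_sum]
      · simp [Prod.snd_sum]
    rw [this, map_add, map_add, map_sum]
    simp [p, l₀, l₁, Prod.fst_sum, Prod.snd_sum, Finset.sum_apply]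
  let b' : (t : ℕ) → Fin (n t) → ℝ := fun t => match t with
    | 0 => 0
    | t + 1 => fun j => if ht : t < N then b ⟨⟨t, ht⟩, j⟩ else 0
  have hb' : ∀ t (ht : t < N) j, b' (t + 1) j = b ⟨⟨t, ht⟩, j⟩ := fun t ht j => dif_pos ht
  refine ⟨a, b', p, l₀, l₁, ha, fun t ht j => ?_, fun t ht j => ?_, ?_, fun z u v huS => ?_⟩
  · rw [hb' t ht]; exact hb _
  · rw [hb' t ht]; exact hbg ⟨⟨t, ht⟩, j⟩
  · rintro ⟨h1, h2, h3, h4, h5⟩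
    refine hne ⟨h1, funext fun i => ?_, ContinuousLinearMap.ext fun y => ?_⟩
    · rw [← hb' i.1 i.1.2, h2 _ i.1.2]; rfl
    · rw [hl, h4, h5, Finset.sum_eq_zero fun t _ => by rw [h3 t t.2]; rfl]
      simp
  · let w : W := (fun i => z₀ i + z i, fun i => u i, v₀ + v)
    have := hstat w fun t => huS t t.2
    rw [hl, Fintype.sum_sigma] at this
    simp only [Finset.sum_range]
    have e1 : ∀ t : Fin N, π t (w - w₀) = (z t, u t - u₀ t) := fun t =>
      Prod.ext (add_sub_cancel_left (z₀ t) (z t)) rfl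
    have e2 : ∀ t, πz t (w - w₀) = z t := fun t => add_sub_cancel_left (z₀ t) (z t)
    have e3 : πv (w - w₀) = v := add_sub_cancel_left v₀ v
    simp only [_root_.add_apply, _root_.sum_apply,
      ContinuousLinearMap.comp_apply, ContinuousLinearMap.prod_apply,
      ContinuousLinearMap.coe_pi', _root_.sub_apply, e1, e2, e3, Fin.val_succ,
      Fin.val_last, Fin.val_zero] at this
    simp only [hb' _ (Fin.is_lt _)]
    linarith

omit [FiniteDimensional ℝ Z] in
/-- Comparison of coefficients: stationarity of a sum over time of functionals of two consecutive
states gives a backward recursion. -/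
theorem recursion_of_stationary {N : ℕ} {α β : ℕ → Z →L[ℝ] ℝ} {κ l₀ : Z →L[ℝ] ℝ}
    (h : ∀ z : ℕ → Z, ∑ t ∈ Finset.range N, (α t (z t) + β t (z (t + 1))) + κ (z N) + l₀ (z 0) = 0) :
    (∀ t, t + 1 < N → α (t + 1) + β t = 0) ∧ (0 < N → β (N - 1) + κ = 0) ∧
      (0 < N → α 0 + l₀ = 0) := by
  refine ⟨fun s hs => ?_, fun hN => ?_, fun hN => ?_⟩ <;> ext y
  · have := h (Pi.single (s + 1) y)
    rw [Finset.sum_add_distrib, Finset.sum_eq_single (s + 1), Finset.sum_eq_single s] at this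
    · have h1 : N ≠ s + 1 := by omega
      simpa [Pi.single_apply, h1] using this
    · intro b _ hb; simp [hb]
    · intro hb; simp at hb; omega
    · intro b _ hb; simp [hb]
    · intro hb; simp at hb; omega
  · obtain ⟨n, rfl⟩ : ∃ n, N = n + 1 := ⟨N - 1, by omega⟩
    have := h (Pi.single (n + 1) y)
    rw [Finset.sum_add_distrib, Finset.sum_eq_zero, Finset.sum_eq_single n] at this
    · simpa [Pi.single_apply] using this
    · intro b _ hb; simp [hb]
    · intro hb; simp at hb
    · intro b hb
      rw [Finset.mem_range] at hb
      simp [hb.ne]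
  · have := h (Pi.single 0 y)
    rw [Finset.sum_add_distrib, Finset.sum_eq_single 0, Finset.sum_eq_zero] at this
    · simpa [Pi.single_apply, hN.ne'] using this
    · intro b _; simp
    · intro b _ hb; simp [hb]
    · intro hb; simp at hb; omega

/-- The discrete-time Pontryagin maximum principle for a problem in a normed space. -/
theorem exists_costates {N : ℕ} (hN : 0 < N)
    {Φ : ℕ → Z × U → Z} {Φ' : ℕ → Z × U →L[ℝ] Z} {c : ℕ → Z × U → ℝ} {c' : ℕ → Z × U →L[ℝ] ℝ}
    {cN : Z → ℝ} {cN' : Z →L[ℝ] ℝ} {n : ℕ → ℕ} {g : (t : ℕ) → Fin (n t) → Z → ℝ}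
    {g' : (t : ℕ) → Fin (n t) → Z →L[ℝ] ℝ} {m : V → Z} {m' : V →L[ℝ] Z}
    {z₀ : ℕ → Z} {u₀ : ℕ → U} {v₀ : V} {S : ℕ → Set U}
    (hS : ∀ t < N, Convex ℝ (S t))
    (hΦ : ∀ t < N, HasStrictFDerivAt (Φ t) (Φ' t) (z₀ t, u₀ t))
    (hc : ∀ t < N, HasStrictFDerivAt (c t) (c' t) (z₀ t, u₀ t))
    (hcN : HasStrictFDerivAt cN cN' (z₀ N))
    (hg : ∀ t < N, ∀ j, HasStrictFDerivAt (g (t + 1) j) (g' (t + 1) j) (z₀ (t + 1)))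
    (hm : HasStrictFDerivAt m m' v₀)
    (hdyn : ∀ t < N, z₀ (t + 1) = Φ t (z₀ t, u₀ t)) (hu : ∀ t < N, u₀ t ∈ S t)
    (hg0 : ∀ t < N, ∀ j, g (t + 1) j (z₀ (t + 1)) ≤ 0) (hfin : z₀ N = m v₀)
    {B : ℕ → Set Z} (hB : ∀ t ≤ N, B t ∈ 𝓝 (z₀ t)) {B' : Set V} (hB' : B' ∈ 𝓝 v₀)
    (hopt : ∀ (z : ℕ → Z) (u : ℕ → U), ∀ v ∈ B', (∀ t ≤ N, z t ∈ B t) → (∀ t < N, u t ∈ S t) →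
      (∀ t < N, z (t + 1) = Φ t (z t, u t)) → z 0 = z₀ 0 → z N = m v →
      (∀ t < N, ∀ j, g (t + 1) j (z (t + 1)) ≤ 0) →
      ∑ t ∈ Finset.range N, c t (z₀ t, u₀ t) + cN (z₀ N) ≤
        ∑ t ∈ Finset.range N, c t (z t, u t) + cN (z N)) :
    ∃ (ν : ℝ) (μ : (t : ℕ) → Fin (n t) → ℝ) (p : ℕ → Z →L[ℝ] ℝ),
      (ν = -1 ∨ ν = 0) ∧
      (∀ t, t + 1 < N → ∀ y, p t y = ν * c' (t + 1) (y, 0) + p (t + 1) (Φ' (t + 1) (y, 0)) +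
        ∑ j, μ (t + 1) j * g' (t + 1) j y) ∧
      (∀ v, p (N - 1) (m' v) - ν * cN' (m' v) - ∑ j, μ N j * g' N j (m' v) = 0) ∧
      (∀ t < N, ∀ w ∈ S t, ν * c' t (0, w - u₀ t) + p t (Φ' t (0, w - u₀ t)) ≤ 0) ∧
      (∀ t < N, ∀ j, μ (t + 1) j * g (t + 1) j (z₀ (t + 1)) = 0) ∧
      (∀ t < N, ∀ j, μ (t + 1) j ≤ 0) ∧
      ¬ (ν = 0 ∧ (∀ t < N, p t = 0) ∧ ∀ t < N, μ (t + 1) = 0) := by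
  obtain ⟨a, b, p, l₀, l₁, ha, hb, hbg, hne, hstat⟩ :=
    exists_control_multipliers hS hΦ hc hcN hg hm hdyn hu hg0 hfin hB hB' hopt
  -- the coefficients of the states in the derivative of the Lagrangian
  let α : ℕ → Z →L[ℝ] ℝ := fun t =>
    (a • c' t - p t ∘L Φ' t) ∘L ContinuousLinearMap.inl ℝ Z U
  let β : ℕ → Z →L[ℝ] ℝ := fun t => p t + ∑ j, b (t + 1) j • g' (t + 1) j
  have hzero : ∀ (z : ℕ → Z) (v : V),
      ∑ t ∈ Finset.range N, (α t (z t) + β t (z (t + 1))) + (a • cN' + l₁) (z N) + l₀ (z 0) -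
        l₁ (m' v) = 0 := by
    have hpos : ∀ (z : ℕ → Z) (v : V), 0 ≤
        ∑ t ∈ Finset.range N, (α t (z t) + β t (z (t + 1))) + (a • cN' + l₁) (z N) + l₀ (z 0) -
          l₁ (m' v) := by
      intro z v
      have := hstat z u₀ v hu
      convert this using 1
      simp only [sub_self, map_sub, mul_add, Finset.mul_sum, α, β, Finset.sum_add_distrib,
        Finset.sum_sub_distrib, _root_.add_apply, _root_.sub_apply,
        ContinuousLinearMap.comp_apply, _root_.smul_apply,
        _root_.sum_apply, ContinuousLinearMap.inl_apply, smul_eq_mul]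
      ring
    intro z v
    refine le_antisymm ?_ (hpos z v)
    have := hpos (-z) (-v)
    simp only [Pi.neg_apply, map_neg, ← neg_add, Finset.sum_neg_distrib] at this
    linarith
  have hl₁ : ∀ v, l₁ (m' v) = 0 := fun v => by simpa using hzero 0 v
  obtain ⟨hrec, hlast, hinit⟩ := recursion_of_stationary (N := N) (α := α) (β := β)
    (κ := a • cN' + l₁) (l₀ := l₀) fun z => by simpa using hzero z 0
  have hlast := hlast hN
  have hinit := hinit hN
  obtain ⟨k, rfl⟩ : ∃ k, N = k + 1 := ⟨N - 1, by omega⟩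
  rw [Nat.add_sub_cancel] at hlast ⊢
  refine ⟨-a, -b, p, ?_, fun t ht y => ?_, fun v => ?_, fun t ht w hw => ?_, fun t ht j => ?_,
    fun t ht j => ?_, ?_⟩
  · rcases ha with rfl | rfl <;> simp
  · have := DFunLike.congr_fun (hrec t ht) y
    simp [α, β] at this
    simp
    linarith
  · have := DFunLike.congr_fun hlast (m' v)
    simp [β, hl₁] at this
    simp
    linarith
  · have := hstat 0 (Function.update u₀ t w) 0 fun s hs => by
      by_cases h : s = t
      · subst h; simpa using hw
      · simpa [h] using hu s hs
    have e : ∀ s, Function.update u₀ t w s - u₀ s = if s = t then w - u₀ t else 0 := fun s => by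
      by_cases h : s = t
      · subst h; simp
      · simp [h]
    simp only [e, Pi.zero_apply, map_zero, mul_zero, Finset.sum_const_zero, add_zero, zero_sub,
      map_neg, neg_zero] at this
    rw [Finset.sum_eq_single t, Finset.sum_eq_single t] at this
    · simp at this
      linarith
    all_goals first
      | (intro s _ hs; simp [hs, ← Prod.zero_eq_mk])
      | (intro hs; simp at hs; omega)
  · simpa using hbg t ht j
  · simpa using hb t ht j
  · rintro ⟨h1, h2, h3⟩
    have ha0 : a = 0 := by simpa using h1
    have hb0 : ∀ t < k + 1, b (t + 1) = 0 := fun t ht => by simpa using h3 t ht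
    refine hne ⟨ha0, hb0, h2, ?_, ?_⟩
    · simpa [α, ha0, h2 0 hN] using hinit
    · simpa [β, ha0, h2 k (by omega), hb0 k (by omega)] using hlast

end Costates

theorem hasFDerivAt_comp_prodMk_left {E F Y : Type*} [NormedAddCommGroup E] [NormedSpace ℝ E]
    [NormedAddCommGroup F] [NormedSpace ℝ F] [NormedAddCommGroup Y] [NormedSpace ℝ Y]
    {f : E × F → Y} {f' : E × F →L[ℝ] Y} {e : E} {u : F} (h : HasFDerivAt f f' (e, u)) :
    HasFDerivAt (fun e => f (e, u)) (f' ∘L ContinuousLinearMap.inl ℝ E F) e :=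
  h.comp e (hasFDerivAt_prodMk_left e u)

theorem hasFDerivAt_comp_prodMk_right {E F Y : Type*} [NormedAddCommGroup E] [NormedSpace ℝ E]
    [NormedAddCommGroup F] [NormedSpace ℝ F] [NormedAddCommGroup Y] [NormedSpace ℝ Y]
    {f : E × F → Y} {f' : E × F →L[ℝ] Y} {e : E} {u : F} (h : HasFDerivAt f f' (e, u)) :
    HasFDerivAt (fun u => f (e, u)) (f' ∘L ContinuousLinearMap.inr ℝ E F) u :=
  h.comp u (hasFDerivAt_prodMk_right e u)

/-! ### Exponential charts of a matrix Lie group -/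

namespace MatrixLieGroup

variable {𝕜 : Type*} [RCLike 𝕜] {m : ℕ} {G : MatrixLieGroup 𝕜 m}
  {X : Type*} [NormedAddCommGroup X] [NormedSpace ℝ X]
  {Y : Type*} [NormedAddCommGroup Y] [NormedSpace ℝ Y]

theorem mat_injective : Function.Injective (mat : G → Mat 𝕜 m) :=
  fun _ _ h => Subtype.ext (Units.ext h)

theorem isInducing_mat : IsInducing (mat : G → Mat 𝕜 m) :=
  Units.isOpenEmbedding_val.isInducing.comp IsInducing.subtypeVal

theorem exp_zero : exp (0 : G.lieAlgebra) = 1 :=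
  mat_injective (NormedSpace.exp_zero)

theorem exp_neg (χ : G.lieAlgebra) : exp (-χ) = (exp χ)⁻¹ := by
  refine eq_inv_of_mul_eq_one_left (mat_injective ?_)
  exact (expGL (χ : Mat 𝕜 m)).inv_val

theorem exp_Ad (q : G) (χ : G.lieAlgebra) : exp (Ad q χ) = q * exp χ * q⁻¹ :=
  mat_injective (NormedSpace.exp_units_conj (q : (Mat 𝕜 m)ˣ) (χ : Mat 𝕜 m))

theorem contDiff_mat_exp : ContDiff ℝ ∞ (fun χ : G.lieAlgebra => mat (exp χ)) := by
  have h : ContDiff ℝ ∞ (NormedSpace.exp : Mat 𝕜 m → Mat 𝕜 m) :=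
    contDiff_iff_contDiffAt.2 fun x => (NormedSpace.exp_analytic (𝕂 := ℝ) x).contDiffAt
  exact h.comp G.lieAlgebra.subtypeL.contDiff

theorem hasStrictFDerivAt_mat_exp :
    HasStrictFDerivAt (fun χ : G.lieAlgebra => mat (exp χ)) G.lieAlgebra.subtypeL 0 := by
  have h := hasStrictFDerivAt_exp_zero (𝕂 := ℝ) (𝔸 := Mat 𝕜 m)
  exact HasStrictFDerivAt.comp (g := (NormedSpace.exp : Mat 𝕜 m → Mat 𝕜 m)) (g' := 1)
    (0 : G.lieAlgebra) (by simpa using h) G.lieAlgebra.subtypeL.hasStrictFDerivAt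

/-- In the exponential chart centred at `q`, a smooth map on `G × X` is strictly differentiable at
the centre. -/
theorem IsSmooth.exists_hasStrictFDerivAt {f : G × X → Y} (hf : IsSmooth f) (q : G) (x : X) :
    ∃ f' : G.lieAlgebra × X →L[ℝ] Y,
      HasStrictFDerivAt (fun z : G.lieAlgebra × X => f (q * exp z.1, z.2)) f' (0, x) := by
  obtain ⟨U, hU, hmem, F, hF, hFf⟩ := hf (q, x) (Set.mem_univ _)
  have hE : ContDiff ℝ ∞ (fun z : G.lieAlgebra × X => (mat q * mat (exp z.1), z.2)) :=
    (contDiff_const.mul ((contDiff_mat_exp (G := G)).comp contDiff_fst)).prodMk contDiff_snd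
  have h0 : (mat q * mat (exp (0 : G.lieAlgebra)), x) = (mat q, x) := by
    rw [exp_zero, mat_one, mul_one]
  have hFc : ContDiffAt ℝ ∞ F (mat q * mat (exp (0 : G.lieAlgebra)), x) := by
    rw [h0]; exact hF.contDiffAt (hU.mem_nhds hmem)
  have hc := (ContDiffAt.comp (g := F) (0, x) hFc hE.contDiffAt).hasStrictFDerivAt (by simp)
  refine ⟨_, hc.congr_of_eventuallyEq ?_⟩
  have : ∀ᶠ z in 𝓝 ((0 : G.lieAlgebra), x), (mat q * mat (exp z.1), z.2) ∈ U :=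
    hE.continuous.continuousAt.eventually (by
      show U ∈ 𝓝 (mat q * mat (exp (0 : G.lieAlgebra)), x)
      rw [h0]; exact hU.mem_nhds hmem)
  filter_upwards [this] with z hz
  exact hFf (q * exp z.1, z.2) (Set.mem_univ _) hz

theorem exp_log {O : Set G.lieAlgebra} {p : G} (hp : p ∈ exp '' O) : exp (log O p) = p :=
  Function.invFunOn_eq hp

/-- If `exp (κ χ) = p exp χ` for small `χ`, then the derivative of `κ` at `0` is invertible,
because `χ ↦ p χ` is injective. -/
theorem exists_continuousLinearEquiv_of_exp_comp {κ : G.lieAlgebra → G.lieAlgebra} {p : G}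
    {K : G.lieAlgebra →L[ℝ] G.lieAlgebra} (hκ : HasStrictFDerivAt κ K 0)
    (h : ∀ᶠ χ in 𝓝 (0 : G.lieAlgebra), exp (κ χ) = p * exp χ) :
    ∃ Λ : G.lieAlgebra ≃L[ℝ] G.lieAlgebra, HasStrictFDerivAt κ (Λ : _ →L[ℝ] _) 0 := by
  have hE : HasStrictFDerivAt (fun χ : G.lieAlgebra => mat (exp χ)) _ (κ 0) :=
    (contDiff_mat_exp (G := G)).contDiffAt.hasStrictFDerivAt (by simp)
  have h1 := (hE.comp 0 hκ).hasFDerivAt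
  have h2 : HasFDerivAt (fun χ : G.lieAlgebra => mat p * mat (exp χ)) _ 0 :=
    (hasStrictFDerivAt_mat_exp (G := G)).hasFDerivAt.const_mul (mat p)
  have h3 := h1.unique (h2.congr_of_eventuallyEq (by
    filter_upwards [h] with χ hχ
    exact congrArg mat hχ))
  have hinj : Function.Injective K := by
    rw [injective_iff_map_eq_zero]
    intro χ hχ
    have h4 := DFunLike.congr_fun h3 χ
    simp only [ContinuousLinearMap.comp_apply, hχ, map_zero] at h4
    have h5 : mat p * (χ : Mat 𝕜 m) = mat p * 0 := by rw [mul_zero]; exact h4.symm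
    exact Subtype.ext (mulLeft_mat_injective p h5)
  refine ⟨(LinearEquiv.ofInjectiveEndo (K : G.lieAlgebra →ₗ[ℝ] G.lieAlgebra)
    hinj).toContinuousLinearEquiv, hκ.congr_fderiv ?_⟩
  ext χ
  rfl

variable {O : Set G.lieAlgebra}

/-- Near a point of `exp(O)`, the inverse `log O` of the exponential map extends to a smooth map
on the space of matrices. -/
theorem IsExpDiffeo.exists_extension (hO : IsExpDiffeo O) {p : G} (hp : p ∈ exp '' O) :
    ∃ F : Mat 𝕜 m → G.lieAlgebra, ContDiffAt ℝ ∞ F (mat p) ∧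
      ∀ᶠ A in 𝓝 (mat p), ∀ g : G, mat g = A → g ∈ exp '' O ∧ F A = log O g := by
  obtain ⟨U, hU, hmem, F, hF, hFl⟩ := hO.smooth_log p hp
  obtain ⟨V, hV, hVO⟩ := isInducing_mat.isOpen_iff.1 hO.isOpen_image
  have hpV : mat p ∈ V := by rw [← hVO] at hp; exact hp
  refine ⟨F, hF.contDiffAt (hU.mem_nhds hmem), ?_⟩
  filter_upwards [hU.mem_nhds hmem, hV.mem_nhds hpV] with A hAU hAV
  rintro g rfl
  have hg : g ∈ exp '' O := by rw [← hVO]; exact hAV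
  exact ⟨hg, hFl g hg hAU⟩

theorem tendsto_mul_mat_exp (p : G) :
    Tendsto (fun χ : G.lieAlgebra => mat p * mat (exp χ)) (𝓝 0) (𝓝 (mat p)) := by
  have : Continuous fun χ : G.lieAlgebra => mat p * mat (exp χ) :=
    continuous_const.mul (contDiff_mat_exp (G := G)).continuous
  simpa [exp_zero, mat_one] using this.tendsto 0

/-- The derivative of `exp⁻¹` at `p ∈ exp(O)`, read in the exponential chart centred at `p`, is
invertible. -/
theorem IsExpDiffeo.exists_hasStrictFDerivAt_log (hO : IsExpDiffeo O) {p : G} (hp : p ∈ exp '' O) :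
    ∃ Λ : G.lieAlgebra ≃L[ℝ] G.lieAlgebra,
      HasStrictFDerivAt (fun χ => log O (p * exp χ)) (Λ : _ →L[ℝ] _) 0 := by
  obtain ⟨F, hF, hFl⟩ := hO.exists_extension hp
  have hev := (tendsto_mul_mat_exp p).eventually hFl
  have h0 : mat p * mat (exp (0 : G.lieAlgebra)) = mat p := by rw [exp_zero, mat_one, mul_one]
  rw [← h0] at hF
  have hd := (hF.comp (0 : G.lieAlgebra)
    (contDiff_const.mul (contDiff_mat_exp (G := G))).contDiffAt).hasStrictFDerivAt (by simp)
  refine exists_continuousLinearEquiv_of_exp_comp (p := p) (hd.congr_of_eventuallyEq ?_) ?_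
  · filter_upwards [hev] with χ hχ using (hχ (p * exp χ) rfl).2
  · filter_upwards [hev] with χ hχ using exp_log (hχ (p * exp χ) rfl).1

/-- A logarithm near the identity of `G`, defined on a neighbourhood of `1` in the space of
matrices. It is obtained by translating the inverse of `exp` on `exp(O)` to the identity. The set
`O` need not contain `0`. -/
theorem IsExpDiffeo.exists_localLog (hO : IsExpDiffeo O) (hne : (exp '' O).Nonempty) :
    ∃ (L : Mat 𝕜 m → G.lieAlgebra) (L' : Mat 𝕜 m →L[ℝ] G.lieAlgebra),
      HasStrictFDerivAt L L' 1 ∧ L 1 = 0 ∧ (∀ χ : G.lieAlgebra, L' χ = χ) ∧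
      ∀ᶠ A in 𝓝 (1 : Mat 𝕜 m), ∀ g : G, mat g = A → exp (L A) = g := by
  obtain ⟨p, hp⟩ := hne
  obtain ⟨F, hF, hFl⟩ := hO.exists_extension hp
  have hlogp : F (mat p) = log O p := (hFl.self_of_nhds p rfl).2
  obtain ⟨Λ, hΛ⟩ := hO.exists_hasStrictFDerivAt_log hp
  have hev := (tendsto_mul_mat_exp p).eventually hFl
  set κ : G.lieAlgebra → G.lieAlgebra := fun χ => log O (p * exp χ) with hκ
  have hκ0 : κ 0 = log O p := by simp [hκ, exp_zero]
  have : CompleteSpace G.lieAlgebra := FiniteDimensional.complete ℝ _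
  let R := hΛ.localInverse κ Λ 0
  have hR0 : R (log O p) = 0 := hκ0 ▸ hΛ.localInverse_apply_image
  have hRd : HasStrictFDerivAt R (Λ.symm : _ →L[ℝ] _) (log O p) := hκ0 ▸ hΛ.to_localInverse
  have hRr : ∀ᶠ y in 𝓝 (log O p), κ (R y) = y := hκ0 ▸ hΛ.eventually_right_inverse
  have hRl : ∀ᶠ χ in 𝓝 0, R (κ χ) = χ := hΛ.eventually_left_inverse
  -- the chart `A ↦ exp⁻¹ (p A)` of `G` near the identity
  let ψ : Mat 𝕜 m → G.lieAlgebra := fun A => F (mat p * A)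
  have hψ1 : ψ 1 = log O p := by simp only [ψ, mul_one, hlogp]
  have hψd : HasStrictFDerivAt ψ (fderiv ℝ ψ 1) 1 := by
    have hF' : ContDiffAt ℝ ∞ F (mat p * 1) := by rwa [mul_one]
    exact (hF'.comp (1 : Mat 𝕜 m) (contDiff_const.mul contDiff_id).contDiffAt).hasStrictFDerivAt
      (by simp)
  have hRd' : HasStrictFDerivAt R (Λ.symm : _ →L[ℝ] _) (ψ 1) := hψ1.symm ▸ hRd
  have hL := hRd'.comp (1 : Mat 𝕜 m) hψd
  have hL1 : R (ψ 1) = 0 := by rw [hψ1, hR0]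
  refine ⟨fun A => R (ψ A), _, hL, hL1, ?_, ?_⟩
  · have hc := HasStrictFDerivAt.comp (g := R ∘ ψ) (0 : G.lieAlgebra)
      (by rw [exp_zero, mat_one]; exact hL) (hasStrictFDerivAt_mat_exp (G := G))
    have hid : HasStrictFDerivAt (fun χ : G.lieAlgebra => χ)
        (ContinuousLinearMap.id ℝ G.lieAlgebra) 0 := hasStrictFDerivAt_id _
    have huniq := hc.hasFDerivAt.unique (hid.hasFDerivAt.congr_of_eventuallyEq (by
      filter_upwards [hev, hRl] with χ h1 h2
      have h3 : ψ (mat (exp χ)) = κ χ := (h1 (p * exp χ) rfl).2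
      simp only [Function.comp, h3, h2]))
    exact fun χ => DFunLike.congr_fun huniq χ
  · have hψc : Tendsto ψ (𝓝 1) (𝓝 (log O p)) := hψ1 ▸ hψd.hasFDerivAt.continuousAt
    have hLc : Tendsto (fun A => R (ψ A)) (𝓝 1) (𝓝 0) := by
      have := hL.hasFDerivAt.continuousAt.tendsto
      simp only [hL1] at this
      exact this
    have hpc : Tendsto (fun A : Mat 𝕜 m => mat p * A) (𝓝 1) (𝓝 (mat p)) := by
      have : Continuous fun A : Mat 𝕜 m => mat p * A := continuous_const.mul continuous_id
      simpa using this.tendsto 1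
    filter_upwards [hψc.eventually hRr, hLc.eventually hev, hpc.eventually hFl] with A h1 h2 h3
    rintro g rfl
    have e1 : exp (κ (R (ψ (mat g)))) = p * exp (R (ψ (mat g))) :=
      exp_log (h2 (p * exp (R (ψ (mat g)))) rfl).1
    have e2 : exp (ψ (mat g)) = p * g := by
      have := h3 (p * g) rfl
      show exp (F (mat p * mat g)) = p * g
      rw [this.2, exp_log this.1]
    rw [h1, e2] at e1
    exact (mul_left_cancel e1).symm

/-! ### Partial derivatives in exponential charts -/

theorem derivQ_leftTranslation {F : G × X → Y} {F' : G.lieAlgebra × X →L[ℝ] Y} {q : G} {x : X}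
    (h : HasFDerivAt (fun z : G.lieAlgebra × X => F (q * exp z.1, z.2)) F' (0, x))
    (χ : G.lieAlgebra) : derivQ F q x (leftTranslation q χ) = F' (χ, 0) := by
  have h1 : HasFDerivAt (fun χ : G.lieAlgebra => F (q * exp χ, x))
      (F' ∘L ContinuousLinearMap.inl ℝ G.lieAlgebra X) 0 :=
    hasFDerivAt_comp_prodMk_left h
  simp [derivQ, mderiv, h1.fderiv]

theorem derivX_apply {F : G × X → Y} {F' : G.lieAlgebra × X →L[ℝ] Y} {q : G} {x : X}
    (h : HasFDerivAt (fun z : G.lieAlgebra × X => F (q * exp z.1, z.2)) F' (0, x))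
    (y : X) : derivX F q x y = F' (0, y) := by
  have h1 : HasFDerivAt (fun y : X => F (q * exp 0, y))
      (F' ∘L ContinuousLinearMap.inr ℝ G.lieAlgebra X) x :=
    hasFDerivAt_comp_prodMk_right h
  simp only [exp_zero, mul_one] at h1
  simp [derivX, h1.fderiv]

theorem derivQX_leftTranslation {F : G × X → Y} {F' : G.lieAlgebra × X →L[ℝ] Y} {q : G} {x : X}
    (h : HasFDerivAt (fun z : G.lieAlgebra × X => F (q * exp z.1, z.2)) F' (0, x))
    (z : G.lieAlgebra × X) : derivQX F q x (leftTranslation q z.1, z.2) = F' z := by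
  rw [derivQX, ContinuousLinearMap.coprod_apply, derivQ_leftTranslation h, derivX_apply h,
    ← map_add, Prod.mk_add_mk, add_zero, zero_add]

/-- The costate `ρ` determined by `ζ`, in terms of the derivative `Λ` of `exp⁻¹` read in the
exponential chart. -/
theorem codexp_eq {η : G.lieAlgebra} {Λ : G.lieAlgebra →L[ℝ] G.lieAlgebra}
    (h : HasFDerivAt (fun χ => log O (exp η * exp χ)) Λ 0) (ζ : G.lieAlgebra →L[ℝ] ℝ) :
    codexp O η ζ = ζ ∘L Λ := by
  ext χ
  simp [codexp, cotangentTriv, mderiv, h.fderiv]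

/-- An immersed submanifold of `G × X` in exponential coordinates centred at one of its points. -/
theorem exists_parametrization {k : ℕ} {M : Type*} [TopologicalSpace M]
    [ChartedSpace (EuclideanSpace ℝ (Fin k)) M]
    {ι : M → G × X} {L : Mat 𝕜 m → G.lieAlgebra} {L' : Mat 𝕜 m →L[ℝ] G.lieAlgebra}
    (hL : HasStrictFDerivAt L L' 1) (hL1 : L 1 = 0)
    (hexp : ∀ᶠ A in 𝓝 (1 : Mat 𝕜 m), ∀ g : G, mat g = A → exp (L A) = g)
    (hι : ContMDiff 𝓘(ℝ, EuclideanSpace ℝ (Fin k)) 𝓘(ℝ, Mat 𝕜 m × X) ∞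
      (fun p => (mat (ι p).1, (ι p).2))) {p : M} {q : G} {x : X} (hp : ι p = (q, x)) :
    ∃ (φ : EuclideanSpace ℝ (Fin k) → G.lieAlgebra × X)
      (φ' : EuclideanSpace ℝ (Fin k) →L[ℝ] G.lieAlgebra × X) (v₀ : EuclideanSpace ℝ (Fin k)),
      HasStrictFDerivAt φ φ' v₀ ∧ φ v₀ = (0, x) ∧
      (∀ᶠ v in 𝓝 v₀, (q * exp (φ v).1, (φ v).2) ∈ Set.range ι) ∧
      ∀ w, ambientDeriv (k := k) ι p w = (mat q * ((φ' w).1 : Mat 𝕜 m), (φ' w).2) := by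
  set e := extChartAt 𝓘(ℝ, EuclideanSpace ℝ (Fin k)) p with he
  let J : EuclideanSpace ℝ (Fin k) → Mat 𝕜 m × X := fun v =>
    (mat (ι (e.symm v)).1, (ι (e.symm v)).2)
  have hJ0 : J (e p) = (mat q, x) := by simp [J, he, hp]
  have hJc : ContDiffAt ℝ ∞ J (e p) := by
    have := (contMDiffAt_iff.1 (hι p)).2
    simp only [extChartAt_model_space_eq_id, PartialEquiv.refl_coe, Function.id_comp,
      modelWithCornersSelf_coe, Set.range_id, contDiffWithinAt_univ] at this
    exact this
  have hJd : HasFDerivAt J (ambientDeriv ι p) (e p) := by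
    have hd := ((hι p).mdifferentiableAt (by simp)).hasMFDerivAt.2
    simp only [writtenInExtChartAt, extChartAt_model_space_eq_id, PartialEquiv.refl_coe,
      Function.id_comp, modelWithCornersSelf_coe, Set.range_id] at hd
    exact hasFDerivWithinAt_univ.1 hd
  have hJs : HasStrictFDerivAt J (ambientDeriv ι p) (e p) := hJc.hasStrictFDerivAt' hJd (by simp)
  have hJ1 : HasStrictFDerivAt (fun v => mat q⁻¹ * (J v).1)
      (ContinuousLinearMap.mul ℝ (Mat 𝕜 m) (mat q⁻¹) ∘L ContinuousLinearMap.fst ℝ _ _ ∘L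
        ambientDeriv ι p) (e p) :=
    (ContinuousLinearMap.mul ℝ (Mat 𝕜 m) (mat q⁻¹) ∘L
      ContinuousLinearMap.fst ℝ (Mat 𝕜 m) X).hasStrictFDerivAt.comp (e p) hJs
  have hone : mat q⁻¹ * (J (e p)).1 = 1 := by rw [hJ0, mat_inv_mul]
  have hL2 : HasStrictFDerivAt L L' (mat q⁻¹ * (J (e p)).1) := hone.symm ▸ hL
  have hφ := (hL2.comp (e p) hJ1).prodMk
    ((ContinuousLinearMap.snd ℝ (Mat 𝕜 m) X).hasStrictFDerivAt.comp (e p) hJs)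
  have hLe : L (mat q⁻¹ * (J (e p)).1) = 0 := by rw [hone, hL1]
  have hcont : Tendsto (fun v => mat q⁻¹ * (J v).1) (𝓝 (e p)) (𝓝 1) :=
    hone ▸ hJ1.hasFDerivAt.continuousAt.tendsto
  have hqexp : ∀ᶠ v in 𝓝 (e p), q * exp (L (mat q⁻¹ * (J v).1)) = (ι (e.symm v)).1 := by
    filter_upwards [hcont.eventually hexp] with v hv
    rw [hv (q⁻¹ * (ι (e.symm v)).1) rfl, mul_inv_cancel_left]
  refine ⟨fun v => (L (mat q⁻¹ * (J v).1), (J v).2), _, e p, hφ, ?_, ?_, fun w => ?_⟩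
  · exact Prod.ext hLe (congrArg (fun y => y.2) hJ0)
  · filter_upwards [hqexp] with v hv
    exact ⟨e.symm v, by rw [hv]⟩
  · have h1 : HasFDerivAt (fun v => mat q * mat (exp (L (mat q⁻¹ * (J v).1)))) _ (e p) :=
      (HasFDerivAt.comp (g := fun χ : G.lieAlgebra => mat (exp χ)) (e p)
        (hLe.symm ▸ (hasStrictFDerivAt_mat_exp (G := G)).hasFDerivAt)
        (hL2.comp (e p) hJ1).hasFDerivAt).const_mul (mat q)
    have h2 : HasFDerivAt (fun v => (J v).1) (ContinuousLinearMap.fst ℝ _ _ ∘L ambientDeriv ι p)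
      (e p) := (ContinuousLinearMap.fst ℝ (Mat 𝕜 m) X).hasFDerivAt.comp (e p) hJd
    have h3 := h2.unique (h1.congr_of_eventuallyEq (by
      filter_upwards [hqexp] with v hv
      exact (congrArg mat hv).symm))
    exact Prod.ext (DFunLike.congr_fun h3 w) rfl

end MatrixLieGroup

/-- The derivative of the affine function `z ↦ r + ⟨z, v⟩ + s` on the dual space is `v`. -/
theorem derivDual_eq_of_affine {V : Type*} [NormedAddCommGroup V] [NormedSpace ℝ V]
    {h : (V →L[ℝ] ℝ) → ℝ} {r s : ℝ} {v : V} (hh : ∀ z, h z = r + z v + s) (a : V →L[ℝ] ℝ) :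
    derivDual h a = v := by
  have hd : HasFDerivAt h (NormedSpace.inclusionInDoubleDual ℝ V v) a := by
    have h1 : h = fun z => r + NormedSpace.inclusionInDoubleDual ℝ V v z + s := funext hh
    rw [h1]
    exact ((ContinuousLinearMap.hasFDerivAt _).const_add r).add_const s
  rw [derivDual, hd.fderiv]
  exact Function.leftInverse_invFun
    (NormedSpace.inclusionInDoubleDualLi (𝕜 := ℝ) (E := V)).injective v

/-! ### The dynamics in exponential coordinates -/

namespace MatrixLieGroup

variable {𝕜 : Type*} [RCLike 𝕜] {m : ℕ} {G : MatrixLieGroup 𝕜 m}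
  {X : Type*} [NormedAddCommGroup X] [NormedSpace ℝ X]
  {Y : Type*} [NormedAddCommGroup Y] [NormedSpace ℝ Y]
  {U : Type*} [NormedAddCommGroup U] [NormedSpace ℝ U] {O : Set G.lieAlgebra}
  {L : Mat 𝕜 m → G.lieAlgebra} {L' : Mat 𝕜 m →L[ℝ] G.lieAlgebra}

/-- The variant of `IsSmooth.exists_hasStrictFDerivAt` for maps that depend on a state in `G × X`
and a control in `U`. -/
theorem IsSmooth.exists_hasStrictFDerivAt_assoc {f : G × X × U → Y} (hf : IsSmooth f)
    (q : G) (x : X) (u : U) :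
    ∃ f' : (G.lieAlgebra × X) × U →L[ℝ] Y,
      HasStrictFDerivAt (fun w : (G.lieAlgebra × X) × U => f (q * exp w.1.1, w.1.2, w.2)) f'
        ((0, x), u) := by
  obtain ⟨f', hf'⟩ := hf.exists_hasStrictFDerivAt q (x, u)
  exact ⟨_, hasStrictFDerivAt_comp_clm
    (φ := fun z : G.lieAlgebra × X × U => f (q * exp z.1, z.2))
    (ContinuousLinearEquiv.prodAssoc ℝ G.lieAlgebra X U :
    (G.lieAlgebra × X) × U →L[ℝ] G.lieAlgebra × X × U) rfl hf'⟩

/-- The group law in logarithmic coordinates has derivative `(a, b) ↦ a + b` at the identity. -/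
theorem hasStrictFDerivAt_log_mul (hL : HasStrictFDerivAt L L' 1)
    (hL' : ∀ χ : G.lieAlgebra, L' χ = χ) :
    HasStrictFDerivAt (fun w : G.lieAlgebra × G.lieAlgebra => L (mat (exp w.1) * mat (exp w.2)))
      (ContinuousLinearMap.fst ℝ _ _ + ContinuousLinearMap.snd ℝ _ _) 0 := by
  have h1 : HasStrictFDerivAt (fun w : G.lieAlgebra × G.lieAlgebra => mat (exp w.1)) _ 0 :=
    hasStrictFDerivAt_comp_clm (φ := fun χ : G.lieAlgebra => mat (exp χ))
      (ContinuousLinearMap.fst ℝ G.lieAlgebra G.lieAlgebra) rfl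
      (hasStrictFDerivAt_mat_exp (G := G))
  have h2 : HasStrictFDerivAt (fun w : G.lieAlgebra × G.lieAlgebra => mat (exp w.2)) _ 0 :=
    hasStrictFDerivAt_comp_clm (φ := fun χ : G.lieAlgebra => mat (exp χ))
      (ContinuousLinearMap.snd ℝ G.lieAlgebra G.lieAlgebra) rfl
      (hasStrictFDerivAt_mat_exp (G := G))
  have h0 : mat (exp (0 : G.lieAlgebra)) * mat (exp (0 : G.lieAlgebra)) = 1 := by
    rw [exp_zero, mat_one, mul_one]
  have h3 := h1.mul' h2
  have hL0 : HasStrictFDerivAt L L'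
      (mat (exp (0 : G.lieAlgebra × G.lieAlgebra).1) *
        mat (exp (0 : G.lieAlgebra × G.lieAlgebra).2)) := h0.symm ▸ hL
  refine (HasStrictFDerivAt.comp (g := L) 0 hL0 h3).congr_fderiv ?_
  refine ContinuousLinearMap.ext fun w => ?_
  have e : L' (mat (exp (0 : G.lieAlgebra)) * (w.2 : Mat 𝕜 m) +
      (w.1 : Mat 𝕜 m) * mat (exp (0 : G.lieAlgebra))) = w.1 + w.2 := by
    rw [exp_zero, mat_one, one_mul, mul_one, map_add, hL', hL', add_comm]
  exact e

/-- One step `q ↦ q s(q, x)` of the dynamics on `G` in exponential coordinates centred at the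
reference trajectory, and its derivative. Here `σ'` is the derivative of `exp⁻¹ (p⁻¹ s(q, x))`,
where `p` is the value of `s` at the reference point. -/
theorem exists_step_coordinates (hL : HasStrictFDerivAt L L' 1) (hL1 : L 1 = 0)
    (hL' : ∀ χ : G.lieAlgebra, L' χ = χ)
    (hexp : ∀ᶠ A in 𝓝 (1 : Mat 𝕜 m), ∀ g : G, mat g = A → exp (L A) = g)
    {s : G × X → G} (hs : IsSmooth fun z => mat (s z)) (q : G) (x : X)
    {Λ : G.lieAlgebra →L[ℝ] G.lieAlgebra}
    (hΛ : HasStrictFDerivAt (fun χ => log O (s (q, x) * exp χ)) Λ 0) :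
    ∃ (Ψ : G.lieAlgebra × X → G.lieAlgebra) (σ' : G.lieAlgebra × X →L[ℝ] G.lieAlgebra),
      HasStrictFDerivAt Ψ
        (Ad (s (q, x))⁻¹ ∘L ContinuousLinearMap.fst ℝ G.lieAlgebra X + σ') (0, x) ∧
      Ψ (0, x) = 0 ∧
      (∀ᶠ z in 𝓝 ((0 : G.lieAlgebra), x),
        q * s (q, x) * exp (Ψ z) = q * exp z.1 * s (q * exp z.1, z.2)) ∧
      HasStrictFDerivAt (fun z : G.lieAlgebra × X => log O (s (q * exp z.1, z.2))) (Λ ∘L σ')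
        (0, x) := by
  set p := s (q, x) with hp
  obtain ⟨S', hS'⟩ := hs.exists_hasStrictFDerivAt q x
  -- `σ z` is the logarithm of `p⁻¹ s(z)`
  have hpS : HasStrictFDerivAt
      (fun z : G.lieAlgebra × X => mat p⁻¹ * mat (s (q * exp z.1, z.2)))
      (ContinuousLinearMap.mul ℝ (Mat 𝕜 m) (mat p⁻¹) ∘L S') (0, x) :=
    (ContinuousLinearMap.mul ℝ (Mat 𝕜 m) (mat p⁻¹)).hasStrictFDerivAt.comp (0, x) hS'
  have hone : mat p⁻¹ * mat (s (q * exp (0 : G.lieAlgebra), x)) = 1 := by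
    rw [exp_zero, mul_one, ← hp, mat_inv_mul]
  let σ : G.lieAlgebra × X → G.lieAlgebra := fun z =>
    L (mat p⁻¹ * mat (s (q * exp z.1, z.2)))
  have hσ0 : σ (0, x) = 0 := by simp only [σ, hone, hL1]
  obtain ⟨σ', hσ⟩ : ∃ σ', HasStrictFDerivAt σ σ' (0, x) := by
    have hL0 : HasStrictFDerivAt L L' (mat p⁻¹ * mat (s (q * exp (0 : G.lieAlgebra), x))) :=
      hone.symm ▸ hL
    exact ⟨_, HasStrictFDerivAt.comp (g := L) ((0 : G.lieAlgebra), x) hL0 hpS⟩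
  have hσexp : ∀ᶠ z in 𝓝 ((0 : G.lieAlgebra), x), p * exp (σ z) = s (q * exp z.1, z.2) := by
    have hc : Tendsto (fun z : G.lieAlgebra × X => mat p⁻¹ * mat (s (q * exp z.1, z.2)))
        (𝓝 (0, x)) (𝓝 1) := by
      have := hpS.hasFDerivAt.continuousAt.tendsto
      rwa [hone] at this
    filter_upwards [hc.eventually hexp] with z hz
    rw [show exp (σ z) = _ from hz (p⁻¹ * s (q * exp z.1, z.2)) rfl, mul_inv_cancel_left]
  -- the product `exp (Ad χ) exp (σ z)` in logarithmic coordinates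
  have hA : HasStrictFDerivAt (fun z : G.lieAlgebra × X => (Ad p⁻¹ z.1, σ z))
      ((Ad p⁻¹ ∘L ContinuousLinearMap.fst ℝ G.lieAlgebra X).prod σ') (0, x) :=
    ((Ad p⁻¹ ∘L ContinuousLinearMap.fst ℝ G.lieAlgebra X).hasStrictFDerivAt).prodMk hσ
  have hA0 : ((Ad p⁻¹ (0 : G.lieAlgebra), σ (0, x)) : G.lieAlgebra × G.lieAlgebra) = 0 := by
    rw [map_zero, hσ0]; rfl
  have hβ := hasStrictFDerivAt_log_mul hL hL'
  rw [← hA0] at hβ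
  have hΨ := HasStrictFDerivAt.comp (g := fun w : G.lieAlgebra × G.lieAlgebra =>
    L (mat (exp w.1) * mat (exp w.2))) ((0 : G.lieAlgebra), x) hβ hA
  refine ⟨fun z => L (mat (exp (Ad p⁻¹ z.1)) * mat (exp (σ z))), σ',
    hΨ.congr_fderiv (by ext <;> simp), ?_, ?_, ?_⟩
  · simp only [map_zero, hσ0, exp_zero, mat_one, mul_one, hL1]
  · have hmul : Continuous fun w : G.lieAlgebra × G.lieAlgebra =>
        mat (exp w.1) * mat (exp w.2) :=
      ((contDiff_mat_exp (G := G)).continuous.comp continuous_fst).mul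
        ((contDiff_mat_exp (G := G)).continuous.comp continuous_snd)
    have hc : Tendsto (fun z : G.lieAlgebra × X => mat (exp (Ad p⁻¹ z.1)) * mat (exp (σ z)))
        (𝓝 (0, x)) (𝓝 1) := by
      have h1 := (hmul.tendsto 0).comp (hA0 ▸ hA.hasFDerivAt.continuousAt.tendsto)
      have h2 : mat (exp (0 : G.lieAlgebra × G.lieAlgebra).1) *
        mat (exp (0 : G.lieAlgebra × G.lieAlgebra).2) = 1 := by
        rw [Prod.fst_zero, Prod.snd_zero, exp_zero, mat_one, mul_one]
      rwa [h2] at h1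
    filter_upwards [hc.eventually hexp, hσexp] with z h1 h2
    rw [h1 (exp (Ad p⁻¹ z.1) * exp (σ z)) rfl, ← h2, exp_Ad]
    group
  · have hΛ0 : HasStrictFDerivAt (fun χ => log O (p * exp χ)) Λ (σ (0, x)) := hσ0.symm ▸ hΛ
    have := HasStrictFDerivAt.comp (g := fun χ => log O (p * exp χ)) ((0 : G.lieAlgebra), x) hΛ0 hσ
    refine this.congr_of_eventuallyEq ?_
    filter_upwards [hσexp] with z hz
    simp only [hz]

end MatrixLieGroup

end DiscretePMP

/-! ### The maximum principle on a matrix Lie group -/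

theorem corollary1 {𝕜 : Type*} [RCLike 𝕜] {m nx nu k : ℕ}
    (G : MatrixLieGroup 𝕜 m) (P : ControlProblem G nx nu)
    (hN : 1 ≤ P.N) (O : Set G.lieAlgebra)
    {M : Type*} [TopologicalSpace M] [ChartedSpace (EuclideanSpace ℝ (Fin k)) M]
    [IsManifold 𝓘(ℝ, EuclideanSpace ℝ (Fin k)) ∞ M]
    (ι : M → G × EuclideanSpace ℝ (Fin nx))
    (hι : MatrixLieGroup.IsImmersedSubmanifold (k := k) ι)
    (hP : P.Assumptions (Set.range ι) O)
    (q : ℕ → G) (x : ℕ → EuclideanSpace ℝ (Fin nx)) (u : ℕ → EuclideanSpace ℝ (Fin nu))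
    (hopt : P.IsOptimal (Set.range ι) q x u) :
    ∃ (ζ : ℕ → (G.lieAlgebra →L[ℝ] ℝ)) (ξ : ℕ → (EuclideanSpace ℝ (Fin nx) →L[ℝ] ℝ))
      (μ : (t : ℕ) → Fin (P.ng t) → ℝ) (ν : ℝ),
      (ν = -1 ∨ ν = 0) ∧
      -- `η t = D_ζ H(γ_t)` and `ρ t = (D exp⁻¹(exp (η t)) ∘ T_e Φ_{exp (η t)})^* (ζ t)`
      let η : ℕ → G.lieAlgebra := fun t =>
        derivDual (fun z => P.hamiltonian O ν t z (ξ t) (q t) (x t) (u t)) (ζ t)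
      let ρ : ℕ → (G.lieAlgebra →L[ℝ] ℝ) := fun t => codexp O (η t) (ζ t)
      -- state dynamics
      (∀ t < P.N,
        q (t + 1) = q t * MatrixLieGroup.exp (η t) ∧
        x (t + 1) = derivDual
          (fun z => P.hamiltonian O ν t (ζ t) z (q t) (x t) (u t)) (ξ t)) ∧
      -- adjoint dynamics
      (∀ t, 1 ≤ t → t < P.N →
        ρ (t - 1) =
          MatrixLieGroup.AdDual (MatrixLieGroup.exp (-η t)) (ρ t) +
          MatrixLieGroup.cotangentTriv (q t)
            (MatrixLieGroup.derivQ
                (fun p => P.hamiltonian O ν t (ζ t) (ξ t) p.1 p.2 (u t)) (q t) (x t) +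
              ∑ j, μ t j • MatrixLieGroup.derivQ
                (fun p => P.g t p j) (q t) (x t)) ∧
        ξ (t - 1) =
          MatrixLieGroup.derivX
              (fun p => P.hamiltonian O ν t (ζ t) (ξ t) p.1 p.2 (u t)) (q t) (x t) +
            ∑ j, μ t j • MatrixLieGroup.derivX
              (fun p => P.g t p j) (q t) (x t)) ∧
      -- transversality: the covector annihilates the tangent space of the terminal submanifold
      (∀ v ∈ MatrixLieGroup.tangentSubmanifold (k := k) ι (q P.N) (x P.N),
        ((MatrixLieGroup.cotangentTrivInv (q P.N) (ρ (P.N - 1))).coprod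
            (ξ (P.N - 1)) -
          ν • MatrixLieGroup.derivQX P.cN (q P.N) (x P.N) -
          ∑ j, μ P.N j • MatrixLieGroup.derivQX
            (fun p => P.g P.N p j) (q P.N) (x P.N)) v = 0) ∧
      -- Hamiltonian non-positive gradient condition
      (∀ t < P.N, ∀ w ∈ P.U t,
        fderiv ℝ (fun u' => P.hamiltonian O ν t (ζ t) (ξ t) (q t) (x t) u') (u t)
          (w - u t) ≤ 0) ∧
      -- complementary slackness
      (∀ t, 1 ≤ t → t ≤ P.N → ∀ j, μ t j * P.g t (q t, x t) j = 0) ∧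
      -- non-positivity
      (∀ t, 1 ≤ t → t ≤ P.N → ∀ j, μ t j ≤ 0) ∧
      -- non-triviality
      ¬ (ν = 0 ∧ (∀ t < P.N, ζ t = 0 ∧ ξ t = 0) ∧ ∀ t, 1 ≤ t → t ≤ P.N → μ t = 0) := by
  obtain ⟨hfeas, hmin⟩ := hopt
  have hstep := hP.step_mem q x u hfeas
  obtain ⟨L, L', hL, hL1, hL', hexp⟩ := hP.exp_diffeo.exists_localLog
    ⟨P.s 0 (q 0, x 0), hstep 0 (by omega)⟩
  obtain ⟨p₀, hp₀⟩ := hfeas.final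
  choose! Λ hΛ using fun t (ht : t < P.N) =>
    hP.exp_diffeo.exists_hasStrictFDerivAt_log (hstep t ht)
  choose! Ψ σ' hΨ hΨ0 hΨexp hσ using fun t (ht : t < P.N) =>
    MatrixLieGroup.exists_step_coordinates hL hL1 hL' hexp (hP.smooth_s t ht) (q t) (x t) (hΛ t ht)
  choose! f' hf' using fun t (ht : t < P.N) =>
    (hP.smooth_f t ht).exists_hasStrictFDerivAt_assoc (q t) (x t) (u t)
  choose! c' hc' using fun t (ht : t < P.N) =>
    (hP.smooth_c t ht).exists_hasStrictFDerivAt_assoc (q t) (x t) (u t)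
  choose! g' hg' using fun t (ht : 1 ≤ t ∧ t ≤ P.N) =>
    (hP.smooth_g t ht.1 ht.2).exists_hasStrictFDerivAt (q t) (x t)
  obtain ⟨cN', hcN'⟩ := hP.smooth_cN.exists_hasStrictFDerivAt (q P.N) (x P.N)
  obtain ⟨φ, φ', v₀, hφ, hφ0, hφι, hφ'⟩ :=
    MatrixLieGroup.exists_parametrization hL hL1 hexp hι.smooth hp₀
  have h1 : ∀ t, q t * MatrixLieGroup.exp (0 : G.lieAlgebra) = q t := fun t => by
    rw [MatrixLieGroup.exp_zero, mul_one]
  obtain ⟨ν, μ, p, hν, hadj, htrans, hgrad, hslack, hsign, hnt⟩ := exists_costates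
    (N := P.N) (Z := G.lieAlgebra × EuclideanSpace ℝ (Fin nx)) (by omega)
    (Φ := fun t w => (Ψ t w.1, P.f t (q t * MatrixLieGroup.exp w.1.1, w.1.2, w.2)))
    (Φ' := fun t => ((MatrixLieGroup.Ad (P.s t (q t, x t))⁻¹ ∘L ContinuousLinearMap.fst ℝ _ _ +
      σ' t) ∘L ContinuousLinearMap.fst ℝ _ _).prod (f' t))
    (c := fun t w => P.c t (q t * MatrixLieGroup.exp w.1.1, w.1.2, w.2)) (c' := c')
    (cN := fun z => P.cN (q P.N * MatrixLieGroup.exp z.1, z.2)) (cN' := cN')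
    (n := P.ng) (g := fun t j z => P.g t (q t * MatrixLieGroup.exp z.1, z.2) j)
    (g' := fun t j => EuclideanSpace.proj j ∘L g' t)
    (m := φ) (m' := φ') (z₀ := fun t => (0, x t)) (u₀ := u) (v₀ := v₀) (S := P.U)
    hP.convex_U
    (fun t ht => ((hΨ t ht).comp (((0 : G.lieAlgebra), x t), u t)
      (hasStrictFDerivAt_fst (𝕜 := ℝ))).prodMk (hf' t ht))
    hc' hcN'
    (fun t ht j => (EuclideanSpace.proj j : EuclideanSpace ℝ (Fin (P.ng (t + 1))) →L[ℝ] ℝ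
      ).hasStrictFDerivAt.comp ((0 : G.lieAlgebra), x (t + 1)) (hg' (t + 1) ⟨by omega, ht⟩))
    hφ
    (fun t ht => Prod.ext (hΨ0 t ht).symm (by simp only [h1]; exact hfeas.dyn_x t ht))
    hfeas.control
    (fun t ht j => by simp only [h1]; exact hfeas.state (t + 1) (by omega) ht j)
    hφ0.symm
    -- near the reference trajectory the coordinate dynamics describe the dynamics on `G`
    (B := fun t => {z | t < P.N → q t * P.s t (q t, x t) * MatrixLieGroup.exp (Ψ t z) =
      q t * MatrixLieGroup.exp z.1 * P.s t (q t * MatrixLieGroup.exp z.1, z.2)})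
    (fun t _ => by
      by_cases ht : t < P.N
      · filter_upwards [hΨexp t ht] with z hz _ using hz
      · exact Filter.Eventually.of_forall fun z h => absurd h ht)
    hφι
    (fun z u' v hv hB hu' hdyn hz0 hzN hg => by
      have := hmin (fun t => q t * MatrixLieGroup.exp (z t).1) (fun t => (z t).2) u'
        { dyn_q := fun t ht => by
            have h2 := hB t ht.le ht
            rw [← h2, hdyn t ht, hfeas.dyn_q t ht]
          dyn_x := fun t ht => by rw [hdyn t ht]
          control := hu'
          state := fun t ht htN j => by
            obtain ⟨s, rfl⟩ : ∃ s, t = s + 1 := ⟨t - 1, by omega⟩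
            exact hg s htN j
          init_q := by rw [hz0, h1]; exact hfeas.init_q
          init_x := by rw [hz0]; exact hfeas.init_x
          final := by rw [hzN]; exact hv }
      simpa only [ControlProblem.cost, h1] using this)
  -- the costates on `𝔤` are transported by `Λ t`, the derivative of `exp⁻¹`
  let ζ : ℕ → (G.lieAlgebra →L[ℝ] ℝ) := fun t =>
    (p t ∘L ContinuousLinearMap.inl ℝ _ _) ∘L ((Λ t).symm : G.lieAlgebra →L[ℝ] G.lieAlgebra)
  let ξ : ℕ → (EuclideanSpace ℝ (Fin nx) →L[ℝ] ℝ) := fun t =>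
    p t ∘L ContinuousLinearMap.inr ℝ _ _
  have hζ : ∀ t χ, ζ t (Λ t χ) = p t (χ, 0) := fun t χ => by simp [ζ]
  have hp : ∀ t χ y, p t (χ, y) = p t (χ, 0) + ξ t y := fun t χ y => by
    simp only [ξ, ContinuousLinearMap.comp_apply, ContinuousLinearMap.inr_apply, ← map_add,
      Prod.mk_add_mk, add_zero, zero_add]
  refine ⟨ζ, ξ, μ, ν, hν, ?_⟩
  intro η ρ
  have hη : ∀ t, η t = MatrixLieGroup.log O (P.s t (q t, x t)) := fun t =>
    derivDual_eq_of_affine (fun z => rfl) (ζ t)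
  have hηexp : ∀ t < P.N, MatrixLieGroup.exp (η t) = P.s t (q t, x t) := fun t ht => by
    rw [hη, MatrixLieGroup.exp_log (hstep t ht)]
  have hρ : ∀ t < P.N, ∀ χ, ρ t χ = p t (χ, 0) := fun t ht χ => by
    have h2 : ρ t = ζ t ∘L (Λ t : G.lieAlgebra →L[ℝ] G.lieAlgebra) :=
      MatrixLieGroup.codexp_eq (by rw [hηexp t ht]; exact (hΛ t ht).hasFDerivAt) (ζ t)
    rw [h2]
    exact hζ t χ
  -- the derivative of the Hamiltonian in the coordinates `(χ, x, u)`
  have hH : ∀ t < P.N, HasFDerivAt (fun w : (G.lieAlgebra × EuclideanSpace ℝ (Fin nx)) ×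
      EuclideanSpace ℝ (Fin nu) => P.hamiltonian O ν t (ζ t) (ξ t)
        (q t * MatrixLieGroup.exp w.1.1) w.1.2 w.2)
      (ν • c' t + ζ t ∘L ((Λ t : G.lieAlgebra →L[ℝ] G.lieAlgebra) ∘L σ' t) ∘L
        ContinuousLinearMap.fst ℝ _ _ + ξ t ∘L f' t) ((0, x t), u t) := by
    intro t ht
    have hσ1 := (hσ t ht).comp (((0 : G.lieAlgebra), x t), u t) (hasStrictFDerivAt_fst (𝕜 := ℝ))
    exact ((((hc' t ht).const_mul ν).add ((ζ t).hasStrictFDerivAt.comp _ hσ1)).add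
      ((ξ t).hasStrictFDerivAt.comp _ (hf' t ht))).hasFDerivAt
  -- the costate applied to the linearized dynamics: the term with `Ad` is the transport by the
  -- step on `G`, and the remainder is the derivative of the Hamiltonian
  have hkey : ∀ t z w, ν * c' t (z, w) +
      p t ((((MatrixLieGroup.Ad (P.s t (q t, x t))⁻¹ ∘L ContinuousLinearMap.fst ℝ _ _ +
        σ' t) ∘L ContinuousLinearMap.fst ℝ _ _).prod (f' t)) (z, w)) =
      p t (MatrixLieGroup.Ad (P.s t (q t, x t))⁻¹ z.1, 0) +
        (ν • c' t + ζ t ∘L ((Λ t : G.lieAlgebra →L[ℝ] G.lieAlgebra) ∘L σ' t) ∘L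
          ContinuousLinearMap.fst ℝ (G.lieAlgebra × EuclideanSpace ℝ (Fin nx))
            (EuclideanSpace ℝ (Fin nu)) + ξ t ∘L f' t) (z, w) := by
    intro t z w
    have e : (((MatrixLieGroup.Ad (P.s t (q t, x t))⁻¹ ∘L ContinuousLinearMap.fst ℝ _ _ +
        σ' t) ∘L ContinuousLinearMap.fst ℝ _ _).prod (f' t)) (z, w) =
        ((MatrixLieGroup.Ad (P.s t (q t, x t))⁻¹ z.1, 0) + (σ' t z, f' t (z, w)) :
          G.lieAlgebra × EuclideanSpace ℝ (Fin nx)) := by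
      rw [Prod.mk_add_mk, zero_add]; rfl
    rw [e, map_add, hp t (σ' t z), ← hζ t (σ' t z)]
    simp only [_root_.add_apply, _root_.smul_apply, smul_eq_mul, ContinuousLinearMap.comp_apply,
      ContinuousLinearEquiv.coe_coe, ContinuousLinearMap.coe_fst']
    ring
  have hHz : ∀ t < P.N, HasFDerivAt (fun z : G.lieAlgebra × EuclideanSpace ℝ (Fin nx) =>
      P.hamiltonian O ν t (ζ t) (ξ t) (q t * MatrixLieGroup.exp z.1) z.2 (u t)) _ (0, x t) :=
    fun t ht => hasFDerivAt_comp_prodMk_left (hH t ht)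
  have hgj : ∀ t, 1 ≤ t → t ≤ P.N → ∀ j, HasFDerivAt
      (fun z : G.lieAlgebra × EuclideanSpace ℝ (Fin nx) =>
        P.g t (q t * MatrixLieGroup.exp z.1, z.2) j)
      ((EuclideanSpace.proj j : EuclideanSpace ℝ (Fin (P.ng t)) →L[ℝ] ℝ) ∘L g' t) (0, x t) :=
    fun t ht htN j => (EuclideanSpace.proj j : EuclideanSpace ℝ (Fin (P.ng t)) →L[ℝ] ℝ
      ).hasFDerivAt.comp ((0 : G.lieAlgebra), x t) (hg' t ⟨ht, htN⟩).hasFDerivAt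
  refine ⟨fun t ht => ⟨?_, ?_⟩, fun t ht htN => ⟨?_, ?_⟩, fun v hv => ?_, fun t ht w hw => ?_,
    fun t ht htN j => ?_, fun t ht htN j => ?_, ?_⟩
  · rw [hηexp t ht]; exact hfeas.dyn_q t ht
  · rw [hfeas.dyn_x t ht]
    exact (derivDual_eq_of_affine (s := 0) (fun z => (add_zero _).symm) (ξ t)).symm
  · obtain ⟨s, rfl⟩ : ∃ s, t = s + 1 := ⟨t - 1, by omega⟩
    refine ContinuousLinearMap.ext fun χ => ?_
    have h2 : MatrixLieGroup.exp (-η (s + 1)) = (P.s (s + 1) (q (s + 1), x (s + 1)))⁻¹ := by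
      rw [MatrixLieGroup.exp_neg, hηexp _ htN]
    have h3 : ∀ j, MatrixLieGroup.derivQ (fun p => P.g (s + 1) p j) (q (s + 1)) (x (s + 1))
        (MatrixLieGroup.leftTranslation (q (s + 1)) χ) = _ := fun j =>
      MatrixLieGroup.derivQ_leftTranslation (hgj (s + 1) ht htN.le j) χ
    have h4 := MatrixLieGroup.derivQ_leftTranslation
      (F := fun p => P.hamiltonian O ν (s + 1) (ζ (s + 1)) (ξ (s + 1)) p.1 p.2 (u (s + 1)))
      (hHz (s + 1) htN) χ
    rw [Nat.add_sub_cancel, hρ s (by omega), hadj s htN (χ, 0), hkey]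
    simp only [MatrixLieGroup.AdDual, MatrixLieGroup.cotangentTriv, _root_.add_apply,
      ContinuousLinearMap.comp_apply, ContinuousLinearEquiv.coe_coe, _root_.sum_apply,
      _root_.smul_apply, smul_eq_mul, h2, h3, h4, hρ _ htN, add_assoc]
    rfl
  · obtain ⟨s, rfl⟩ : ∃ s, t = s + 1 := ⟨t - 1, by omega⟩
    refine ContinuousLinearMap.ext fun y => ?_
    have h3 : ∀ j, MatrixLieGroup.derivX (fun p => P.g (s + 1) p j) (q (s + 1)) (x (s + 1)) y = _ :=
      fun j => MatrixLieGroup.derivX_apply (hgj (s + 1) ht htN.le j) y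
    have h4 := MatrixLieGroup.derivX_apply
      (F := fun p => P.hamiltonian O ν (s + 1) (ζ (s + 1)) (ξ (s + 1)) p.1 p.2 (u (s + 1)))
      (hHz (s + 1) htN) y
    rw [Nat.add_sub_cancel, show ξ s y = p s (0, y) from rfl, hadj s htN (0, y), hkey]
    simp only [_root_.add_apply, _root_.sum_apply, _root_.smul_apply, smul_eq_mul, h3, h4,
      map_zero, ← Prod.zero_eq_mk, zero_add]
    rfl
  · obtain ⟨p₁, hp₁, w, hw⟩ := hv
    obtain rfl : p₁ = p₀ := hι.injective (hp₁.trans hp₀.symm)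
    have hv : v = (MatrixLieGroup.leftTranslation (q P.N) (φ' w).1, (φ' w).2) := by
      rw [hφ'] at hw
      exact Prod.ext (Subtype.ext (congrArg Prod.fst hw).symm) (congrArg Prod.snd hw).symm
    subst hv
    have h3 : ∀ j, MatrixLieGroup.derivQX (fun p => P.g P.N p j) (q P.N) (x P.N)
        (MatrixLieGroup.leftTranslation (q P.N) (φ' w).1, (φ' w).2) = _ := fun j =>
      MatrixLieGroup.derivQX_leftTranslation (hgj P.N hN le_rfl j) (φ' w)
    have h4 := MatrixLieGroup.derivQX_leftTranslation hcN'.hasFDerivAt (φ' w)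
    have h5 : (MatrixLieGroup.cotangentTrivInv (q P.N) (ρ (P.N - 1))).coprod (ξ (P.N - 1))
        (MatrixLieGroup.leftTranslation (q P.N) (φ' w).1, (φ' w).2) = p (P.N - 1) (φ' w) := by
      have h6 := hρ (P.N - 1) (by omega) (φ' w).1
      rw [ContinuousLinearMap.coprod_apply, hp _ (φ' w).1 (φ' w).2, ← h6]
      simp [MatrixLieGroup.cotangentTrivInv]
    simp only [_root_.sub_apply, _root_.sum_apply, _root_.smul_apply, smul_eq_mul, h3, h4, h5]
    exact htrans w
  · have h2 := hgrad t ht w hw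
    have h3 := hasFDerivAt_comp_prodMk_right (hH t ht)
    simp only [h1] at h3
    rw [hkey] at h2
    rw [h3.fderiv, ContinuousLinearMap.comp_apply, ContinuousLinearMap.inr_apply]
    simpa only [Prod.fst_zero, map_zero, ← Prod.zero_eq_mk, zero_add] using h2
  · obtain ⟨s, rfl⟩ : ∃ s, t = s + 1 := ⟨t - 1, by omega⟩
    have h2 := hslack s htN j
    simpa only [h1] using h2
  · obtain ⟨s, rfl⟩ : ∃ s, t = s + 1 := ⟨t - 1, by omega⟩
    exact hsign s htN j
  · rintro ⟨h2, h3, h4⟩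
    refine hnt ⟨h2, fun t ht => ContinuousLinearMap.ext fun z => ?_, fun t ht =>
      h4 (t + 1) (by omega) ht⟩
    obtain ⟨χ, y⟩ := z
    rw [hp, ← hζ, (h3 t ht).1, (h3 t ht).2]
    simp
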